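/- Let $M/F$ be a finite field extension of degree $n$ with non-trivial automorphism group $G=\mathrm{Aut}_F(M)$, and let $A$ be a central simple algebra of degree $n$ over $F$ (so $\dim_F A=n^2$) containing $M$. By a cyclic chain in $A$ we mean a finite chain $M=A_0\subset A_1\subset\dots\subset A_k\subseteq A$ of $F$-subalgebras of $A$, all having $M$ as a maximal subfield, such that for all $i\in\{0,\dots,k-1\}$ there is an isomorphism of $F$-algebras $$A_{i+1}\cong A_i[t_i;\tau_i]/A_i[t_i;\tau_i](t_i^{q_i}-c_i),$$ where $q_i$ is a prime; $\tau_i$ is an $F$-automorphism of $A_i$ of inner order $q_i$ (i.e. $q_i$ is the smallest positive integer such that $\tau_i^{q_i}$ is an inner automorphism of $A_i$) which restricts to an automorphism $\sigma_{i+1}\in G$ of $M$; and $c_i\in A_i^{\times}$ with $\tau_i(c_i)=c_i$. Here $A_i[t_i;\tau_i]$ is the twisted polynomial ring with $t_ia=\tau_i(a)t_i$ for $a\in A_i$; the quotient consists of the twisted polynomials of degree less than $q_i$, the product of two of them being the remainder of their product after right division by $t_i^{q_i}-c_i$. (a) If $A$ contains a cyclic chain such that $A_k$ is a $G$-crossed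 product algebra over $\mathrm{Fix}(G)$ with maximal subfield $M$ (that is, $A_k$ is central simple over $\mathrm{Fix}(G)$ of degree $[M:\mathrm{Fix}(G)]$, and $M/\mathrm{Fix}(G)$ is Galois), then $G$ is solvable. (b) Suppose that $M/F$ is Galois, so that $A$ is a $G$-crossed product algebra over $F$ with maximal subfield $M$ and $G=\mathrm{Gal}(M/F)$. Then the following are equivalent: 1. $G$ is solvable, i.e. $A$ is a solvable $G$-crossed product algebra; 2. $A$ contains a cyclic chain with $A_k=A$; 3. $A$ contains a cyclic chain with $A_k=A$ such that moreover every $A_i$ ($0\le i\le k$) is central simple over its center $Z_i$, with $Z_i\subseteq M$ and degree $[M:Z_i]$, and, for $0\le i<k$, $A_{i+1}$ is a generalised cyclic algebra $(A_i,\tau_i,c_i)$, i.e. $\tau_i|_{Z_i}$ has order $q_i$ and $t_i^{q_i}-c_i$ is right invariant (the left ideal which it generates is two-sided), the isomorphism $A_{i+1}\cong A_i[t_i;\tau_i]/A_i[t_i;\tau_i](t_i^{q_i}-c_i)$ being the identity on $A_i$. -/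

import Mathlib

universe u v w

noncomputable section

/-! ### Twisted polynomials and their quotients -/

section Twisted

variable {F : Type u} {S : Type v} [Field F] [Ring S] [Algebra F S]

/-- The action of `ℕ` on `S` by the powers of the `F`-automorphism `τ`.  With this action, Mathlib's
`SkewPolynomial S` is the twisted polynomial ring `S[t;τ]`, in which `t a = τ(a) t`. -/
abbrev twistAction (τ : S ≃ₐ[F] S) : MulSemiringAction (Multiplicative ℕ) S :=
  MulSemiringAction.compHom S (powersHom (S ≃ₐ[F] S) τ)

/-- The twisted polynomial `t ^ q - c`. -/
def twistedBinomial (τ : S ≃ₐ[F] S) (q : ℕ) (c : S) : SkewPolynomial S :=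
  letI := twistAction τ
  SkewPolynomial.X ^ q - SkewPolynomial.C c

/-- `g` has degree less than `m`. -/
def SkewDegreeLT (m : ℕ) (g : SkewPolynomial S) : Prop :=
  ∀ n, m ≤ n → g.coeff n = 0

/-- `f` is right invariant in `R = S[t;τ]`: the left ideal `R f` is two-sided. -/
def IsRightInvariant (τ : S ≃ₐ[F] S) (f : SkewPolynomial S) : Prop :=
  letI := twistAction τ
  ∀ g : SkewPolynomial S, ∃ h : SkewPolynomial S, f * g = h * f

/-- `φ` is an isomorphism of the `F`-algebra `B` with `S[t;τ] / S[t;τ] f`, where `f` is monic of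
degree `m`.  The elements of the quotient are represented by the twisted polynomials `g` of degree
less than `m`, and the product of `g` and `h` is the remainder of `g h` after right division
by `f`, that is, the unique `r` of degree less than `m` such that `g h = p f + r` for some `p`. -/
structure IsTwistedQuotientIso (τ : S ≃ₐ[F] S) (f : SkewPolynomial S) (m : ℕ)
    {B : Type w} [Ring B] [Algebra F B] (φ : B →ₗ[F] SkewPolynomial S) : Prop where
  injective : Function.Injective φ
  range_eq : Set.range φ = {g | SkewDegreeLT m g}
  map_one : letI := twistAction τ
    φ 1 = 1
  map_mul : letI := twistAction τ
    ∀ x y : B, ∃ p : SkewPolynomial S, φ x * φ y = p * f + φ (x * y)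

/-- `τ` has inner order `q`: `q` is the smallest positive integer such that `τ ^ q` is an inner
automorphism `x ↦ u x u⁻¹`. -/
def HasInnerOrder (τ : S ≃ₐ[F] S) (q : ℕ) : Prop :=
  IsLeast {n : ℕ | 0 < n ∧ ∃ u : Sˣ, ∀ x : S, (τ ^ n) x = (u : S) * x * ((u⁻¹ : Sˣ) : S)} q

end Twisted

/-! ### Central simple algebras, maximal subfields and crossed products -/

/-- `A` is a (finite-dimensional) central simple algebra of degree `n` over `K`; the ring `K` will
be a field, or the center of a simple algebra (and hence a field). -/
structure IsCSAOfDegree (K : Type u) (A : Type v) [CommRing K] [Ring A] [Algebra K A]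
    (n : ℕ) : Prop where
  finite : Module.Finite K A
  central : Algebra.IsCentral K A
  simple : IsSimpleRing A
  finrank_eq : Module.finrank K A = n ^ 2

section Subalgebras

variable {F : Type u} {M : Type v} {A : Type w} [Field F] [Field M] [Algebra F M]
  [Ring A] [Algebra F A]

/-- The image of `M` under `ι` is maximal among the subfields of `A` which contain `F` and are
contained in the subalgebra `B`. -/
structure IsMaximalSubfield (ι : M →ₐ[F] A) (B : Subalgebra F A) : Prop where
  le : ι.range ≤ B
  maximal : ∀ L : Subalgebra F A, IsField L → L ≤ B → ι.range ≤ L → L = ι.range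

/-- The subalgebra `B` is a central simple algebra over its center `Z`, and `M` is a maximal
subfield of `B` in the strict sense: `Z ⊆ M ⊆ B`, and `[M : Z]` is the degree `d` of `B`
(here `[M : Z] = d` is written as `[M : F] = d [Z : F]`). -/
structure IsStrictlyMaximalSubfield (ι : M →ₐ[F] A) (B : Subalgebra F A) : Prop where
  le : ι.range ≤ B
  center_le : (Subalgebra.center F B).map B.val ≤ ι.range
  degree : ∃ d : ℕ, IsCSAOfDegree (Subring.center B) B d ∧
    Module.finrank F M = d * Module.finrank F (Subalgebra.center F B)

/-- The subalgebra `B` is a `Gal(M/K)`-crossed product algebra over the intermediate field `K`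
of `M/F`: it is a central simple algebra of degree `[M : K]` with center `K`, and it contains `M`,
which is a Galois extension of `K`. -/
structure IsCrossedProductOver (ι : M →ₐ[F] A) (K : IntermediateField F M)
    (B : Subalgebra F A) : Prop where
  galois : IsGalois K M
  le : ι.range ≤ B
  center_eq : (Subalgebra.center F B).map B.val = K.toSubalgebra.map ι
  csa : IsCSAOfDegree (Subring.center B) B (Module.finrank K M)

/-- One step `B ⊂ B' ≅ B[t;τ] / B[t;τ](t ^ q - c)` of a chain, where `q` is a prime, `τ` is an
`F`-automorphism of `B` of inner order `q` which restricts to an element of `Aut_F(M)`, and `c` is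
an invertible element of `B` fixed by `τ`; the map `φ` is the isomorphism. -/
structure IsCyclicStep (ι : M →ₐ[F] A) (B B' : Subalgebra F A) (q : ℕ) (τ : B ≃ₐ[F] B) (c : B)
    (φ : B' →ₗ[F] SkewPolynomial B) : Prop where
  lt : B < B'
  prime : q.Prime
  innerOrder : HasInnerOrder τ q
  restricts : ∃ σ : M ≃ₐ[F] M, ∀ (x : B) (m : M), (x : A) = ι m → (τ x : A) = ι (σ m)
  fixed : τ c = c
  isUnit : IsUnit c
  iso : IsTwistedQuotientIso τ (twistedBinomial τ q c) q φ

/-- A chain `M = B 0 ⊂ B 1 ⊂ ... ⊂ B k` of subalgebras of `A` which all have maximal subfield `M`,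
each step being as in `IsCyclicStep`. -/
structure IsCyclicChain (ι : M →ₐ[F] A) (k : ℕ) (B : ℕ → Subalgebra F A) : Prop where
  zero : B 0 = ι.range
  maximal : ∀ i, i ≤ k → IsMaximalSubfield ι (B i)
  step : ∀ i, i < k → ∃ (q : ℕ) (τ : B i ≃ₐ[F] B i) (c : B i)
    (φ : B (i + 1) →ₗ[F] SkewPolynomial (B i)), IsCyclicStep ι (B i) (B (i + 1)) q τ c φ

/-- A chain as in `IsCyclicChain` in which moreover every `B i` is central simple over its center
with maximal subfield `M` in the strict sense, every `B (i + 1)` is a generalised cyclic algebra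
`(B i, τ, c)`, i.e. `τ` has order `q` on the center of `B i` and `t ^ q - c` is right invariant, and
the isomorphisms `B (i + 1) ≅ B i[t;τ] / B i[t;τ](t ^ q - c)` are the identity on `B i`. -/
structure IsGeneralisedCyclicChain (ι : M →ₐ[F] A) (k : ℕ) (B : ℕ → Subalgebra F A) : Prop where
  zero : B 0 = ι.range
  maximal : ∀ i, i ≤ k → IsMaximalSubfield ι (B i) ∧ IsStrictlyMaximalSubfield ι (B i)
  step : ∀ i, i < k → ∃ (q : ℕ) (τ : B i ≃ₐ[F] B i) (c : B i)
    (φ : B (i + 1) →ₗ[F] SkewPolynomial (B i)), IsCyclicStep ι (B i) (B (i + 1)) q τ c φ ∧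
      IsLeast {n : ℕ | 0 < n ∧ ∀ z ∈ Subalgebra.center F (B i), (τ ^ n) z = z} q ∧
      IsRightInvariant τ (twistedBinomial τ q c) ∧
      ∀ (x : B i) (y : B (i + 1)), (x : A) = y → φ y = SkewPolynomial.C x

end Subalgebras

end

/-! ### Simple rings and twisted bimodules -/

section SimpleRings

/-! From a chain to solvability: each step presents `B (i + 1)` as free over a copy of `B i` on `1,
t, ..., t ^ (q - 1)`. A minimal-support argument (`HasInnerOrder.exists_single_mem`) shows that
simplicity is inherited and that the new center is the fixed field of `τ` on the old one, up to
isomorphism (`IsTwistedExtension.mem_center_iff`). The isomorphisms need not respect the inclusions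
in `A`, so the centers do not visibly form a tower inside `M`. They are therefore realised as
subfields `L` of the normal closure `N` of `M/F`, and the invariant followed is the set of perfect
subgroups of `Aut(N/L)`. Replacing `L` by the fixed field of one automorphism does not change it:
`Aut(N/L')` acts on `L` through a cyclic group, so its commutator subgroup fixes `L`.

The last center is isomorphic to `K = Fix(G)`. Isomorphic subfields of `N` have conjugate fixing
groups, so `Aut(N/K)` has as many perfect subgroups as `Aut(N/M)`; as it contains the latter, the
two sets agree. The derived series of `Aut(N/K)` ends in a perfect group, which hence fixes `M` and
dies in `Gal(M/K) = G`. So `G` is solvable.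

From solvability to a chain: a Skolem-Noether argument gives units `u σ` inducing each `σ` in `G`,
and these form an `M`-basis of `A` (`exists_isCrossedBasis`). The centralizer of `Fix(H)` is the sum
of the `M u σ` with `σ` in `H`. Along a subnormal series of `G` with prime indices these
centralizers form the chain; each step adjoins `t = u σ`, with `τ` conjugation by `t` and `c = t ^
q` (`IsCrossedBasis.isGeneralisedCyclicStep`). -/

/-- A nonzero two-sided ideal of a simple ring, given by its membership predicate, contains `1`. -/
theorem IsSimpleRing.one_of_ideal {S : Type*} [Ring S] [IsSimpleRing S] (P : S → Prop)
    (zero : P 0) (add : ∀ x y, P x → P y → P (x + y)) (left : ∀ s x, P x → P (s * x))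
    (right : ∀ s x, P x → P (x * s)) {a : S} (ha : P a) (ha0 : a ≠ 0) : P 1 := by
  let I : TwoSidedIdeal S := TwoSidedIdeal.mk' {x | P x} zero (fun {x y} hx hy => add x y hx hy)
    (fun {x} hx => by simpa using left (-1) x hx) (fun {x y} hy => left x y hy)
    (fun {x y} hx => right y x hx)
  have hI : ∀ x, x ∈ I ↔ P x := fun x => TwoSidedIdeal.mem_mk' ..
  rcases eq_bot_or_eq_top I with h | h
  · exact absurd ((TwoSidedIdeal.mem_bot S).1 (h ▸ (hI a).2 ha)) ha0
  · exact (hI 1).1 (h ▸ trivial)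

/-- A ring is simple if every nonzero two-sided ideal contains a unit. -/
theorem isSimpleRing_of_exists_isUnit {S : Type*} [Ring S] [Nontrivial S]
    (h : ∀ I : TwoSidedIdeal S, ∀ a ∈ I, a ≠ 0 → ∃ u ∈ I, IsUnit u) : IsSimpleRing S := by
  refine ⟨⟨fun I => ?_⟩⟩
  by_cases hI : ∃ a ∈ I, a ≠ 0
  · right
    obtain ⟨a, ha, ha0⟩ := hI
    obtain ⟨u, hu, ⟨u, rfl⟩⟩ := h I a ha ha0
    refine TwoSidedIdeal.ext fun x => ⟨fun _ => trivial, fun _ => ?_⟩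
    simpa using I.mul_mem_left (x * (u⁻¹ : Sˣ)) _ hu
  · left
    push Not at hI
    refine TwoSidedIdeal.ext fun x => ⟨fun hx => ?_, fun hx => ?_⟩
    · exact (TwoSidedIdeal.mem_bot S).2 (hI x hx)
    · rw [(TwoSidedIdeal.mem_bot S).1 hx]; exact I.zero_mem

/-- In a simple ring, a nonzero element which is normal up to a ring automorphism is a unit. -/
theorem IsSimpleRing.isUnit_of_semicentral {S : Type*} [Ring S] [IsSimpleRing S] (e : S ≃+* S)
    {a : S} (ha : a ≠ 0) (h : ∀ s, s * a = a * e s) : IsUnit a := by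
  obtain ⟨y, hy⟩ : ∃ y, 1 = y * a := by
    refine IsSimpleRing.one_of_ideal (fun x => ∃ y, x = y * a) ⟨0, by simp⟩ ?_ ?_ ?_
      (a := a) ⟨1, by simp⟩ ha
    · rintro _ _ ⟨x, rfl⟩ ⟨y, rfl⟩; exact ⟨x + y, by rw [add_mul]⟩
    · rintro s _ ⟨y, rfl⟩; exact ⟨s * y, by rw [mul_assoc]⟩
    · rintro s _ ⟨y, rfl⟩
      exact ⟨y * e.symm s, by rw [mul_assoc, mul_assoc, h, e.apply_symm_apply]⟩
  have hy' : a * e y = 1 := by rw [← h, ← hy]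
  exact isUnit_iff_exists_and_exists.2 ⟨⟨_, hy'⟩, ⟨_, hy.symm⟩⟩

open Classical in
/-- A nonzero twisted sub-bimodule of a finite power of a simple ring contains a vector with a
coordinate equal to `1` all of whose coordinates are normal. -/
theorem exists_normalized_mem_of_twisted_bimodule {ι S : Type*} [Fintype ι] [Ring S]
    [IsSimpleRing S] (e : ι → S ≃+* S) (V : AddSubgroup (ι → S))
    (left : ∀ v ∈ V, ∀ s, (fun i => s * v i) ∈ V) (right : ∀ v ∈ V, ∀ s, (fun i => v i * e i s) ∈ V)
    {v : ι → S} (hv : v ∈ V) (hv0 : v ≠ 0) :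
    ∃ w ∈ V, ∃ i₀, w i₀ = 1 ∧ ∀ i s, s * w i = w i * e i ((e i₀).symm s) := by
  obtain ⟨n, hn⟩ : ∃ n, n = (Finset.univ.filter fun i => v i ≠ 0).card := ⟨_, rfl⟩
  induction n using Nat.strong_induction_on generalizing v with
  | _ n ih =>
    obtain ⟨i₀, hi₀⟩ := Function.ne_iff.1 hv0
    -- The `i₀`-coordinates of vectors of `V` supported inside the support of `v` form a two-sided
    -- ideal.
    obtain ⟨w, hwV, hw1, hwv⟩ : ∃ w ∈ V, w i₀ = 1 ∧ ∀ i, v i = 0 → w i = 0 := by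
      refine IsSimpleRing.one_of_ideal (fun x => ∃ w ∈ V, w i₀ = x ∧ ∀ i, v i = 0 → w i = 0)
        ⟨0, V.zero_mem, rfl, fun _ _ => rfl⟩ ?_ ?_ ?_ (a := v i₀) ⟨v, hv, rfl, fun _ h => h⟩ hi₀
      · rintro _ _ ⟨x, hx, rfl, hx'⟩ ⟨y, hy, rfl, hy'⟩
        exact ⟨x + y, V.add_mem hx hy, rfl, fun i hi => by simp [hx' i hi, hy' i hi]⟩
      · rintro s _ ⟨y, hy, rfl, hy'⟩
        exact ⟨_, left y hy s, rfl, fun i hi => by simp [hy' i hi]⟩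
      · rintro s _ ⟨y, hy, rfl, hy'⟩
        exact ⟨_, right y hy ((e i₀).symm s), by simp, fun i hi => by simp [hy' i hi]⟩
    by_cases hall : ∀ i s, s * w i = w i * e i ((e i₀).symm s)
    · exact ⟨w, hwV, i₀, hw1, hall⟩
    · push Not at hall
      obtain ⟨i, s, his⟩ := hall
      -- This nonzero vector has smaller support: its coordinate at `i₀` is `s - s = 0`.
      have hmem := V.sub_mem (left w hwV s) (right w hwV ((e i₀).symm s))
      refine ih _ ?_ hmem (fun h => his (sub_eq_zero.1 (congrFun h i))) rfl
      rw [hn]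
      refine Finset.card_lt_card ⟨fun j hj => ?_, fun hsub => ?_⟩
      · simp only [Finset.mem_filter, Finset.mem_univ, true_and] at hj ⊢
        exact fun h => hj (by simp [hwv j h])
      · have := hsub (Finset.mem_filter.2 ⟨Finset.mem_univ i₀, hi₀⟩)
        simp [hw1] at this

/-- In a central simple algebra, the two-sided multiplications by linearly independent elements are
linearly independent. -/
theorem eq_zero_of_sum_mul_mul_eq_zero {F A ι : Type*} [Fintype ι] [Field F] [Ring A] [Algebra F A]
    [IsSimpleRing A] [Algebra.IsCentral F A] {b : ι → A} (hb : LinearIndependent F b)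
    {a : ι → A} (ha : ∀ x, ∑ i, a i * x * b i = 0) : a = 0 := by
  by_contra h0
  let V : AddSubgroup (ι → A) :=
    { carrier := {a | ∀ x, ∑ i, a i * x * b i = 0}
      zero_mem' := fun x => by simp
      add_mem' := fun {p q} hp hq x => by simp [add_mul, Finset.sum_add_distrib, hp x, hq x]
      neg_mem' := fun {p} hp x => by simp [neg_mul, hp x] }
  obtain ⟨w, hw, i₀, h1, hcomm⟩ := exists_normalized_mem_of_twisted_bimodule
    (fun _ : ι => RingEquiv.refl A) V
    (fun v hv s x => by
      have := congrArg (s * ·) (hv x)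
      simpa [Finset.mul_sum, mul_assoc] using this)
    (fun v hv s x => by simpa [mul_assoc] using hv (s * x)) (v := a) ha h0
  -- A normalized relation has central, hence scalar, coefficients; evaluated at `x = 1` it
  -- contradicts the independence of `b`.
  have hcen : ∀ i, ∃ r : F, algebraMap F A r = w i := fun i => by
    have : w i ∈ Subalgebra.center F A := Subalgebra.mem_center_iff.2 fun s => by
      simpa using hcomm i s
    rwa [Algebra.IsCentral.center_eq_bot, Algebra.mem_bot] at this
  choose r hr using hcen
  have hsum : ∑ i, r i • b i = 0 := by
    have := hw 1
    simpa [← hr, ← Algebra.smul_def] using this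
  have := Fintype.linearIndependent_iff.1 hb r hsum i₀
  rw [← hr, this, map_zero] at h1
  exact zero_ne_one h1

end SimpleRings

/-! ### Twisted extensions: simplicity and center -/

section TwistedExtensions

variable {F S B : Type*} [Field F] [Ring S] [Algebra F S] [Ring B] [Algebra F B]

/-- `B` is free as a left module over the image of `S` under `j`, with basis `1, t, ..., t ^ (q-1)`,
where `t` is a unit of `B` with `t s = τ(s) t` for `s` in `S`. -/
structure IsTwistedExtension (j : S →ₐ[F] B) (τ : S ≃ₐ[F] S) (q : ℕ) (t : B) : Prop where
  comm : ∀ s, t * j s = j (τ s) * t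
  isUnit : IsUnit t
  bijective : Function.Bijective fun b : Fin q → S => ∑ i, j (b i) * t ^ (i : ℕ)

theorem pow_mul_of_twisted {j : S →ₐ[F] B} {τ : S ≃ₐ[F] S} {t : B}
    (comm : ∀ s, t * j s = j (τ s) * t) (n : ℕ) (s : S) : t ^ n * j s = j ((τ ^ n) s) * t ^ n := by
  induction n with
  | zero => simp
  | succ n ih => rw [pow_succ', mul_assoc, ih, ← mul_assoc, comm, pow_succ', mul_assoc]; rfl

/-- A nonzero such `w` is a unit by simplicity, and then `w` or its inverse makes `τ ^ |a - b|`
inner with `0 < |a - b| < q`. -/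
theorem HasInnerOrder.eq_zero_of_normal [IsSimpleRing S] {τ : S ≃ₐ[F] S} {q : ℕ}
    (hτ : HasInnerOrder τ q) {a b : ℕ} (ha : a < q) (hb : b < q) (hab : a ≠ b) {w : S}
    (hw : ∀ s, s * w = w * (τ ^ a) ((τ ^ b).symm s)) : w = 0 := by
  by_contra h0
  obtain ⟨u, rfl⟩ : IsUnit w := IsSimpleRing.isUnit_of_semicentral
    ((τ ^ b).symm.trans (τ ^ a) : S ≃ₐ[F] S).toRingEquiv h0 hw
  rcases lt_or_gt_of_ne hab with h | h
  · refine absurd (hτ.2 ⟨Nat.sub_pos_of_lt h, u, fun x => ?_⟩) (by omega)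
    have h1 := hw ((τ ^ (b - a)) x)
    have h2 : (τ ^ a) ((τ ^ b).symm ((τ ^ (b - a)) x)) = x := by
      have : (τ ^ b) ((τ ^ a).symm x) = (τ ^ (b - a)) x := by
        conv_lhs => rw [show b = (b - a) + a by omega, pow_add]
        simp [AlgEquiv.mul_apply]
      rw [← this, AlgEquiv.symm_apply_apply, AlgEquiv.apply_symm_apply]
    rw [h2] at h1
    rw [← h1, mul_assoc, Units.mul_inv, mul_one]
  · refine absurd (hτ.2 ⟨Nat.sub_pos_of_lt h, u⁻¹, fun x => ?_⟩) (by omega)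
    have h1 := hw x
    have h2 : (τ ^ a) ((τ ^ b).symm x) = (τ ^ (a - b)) x := by
      conv_lhs => rw [show a = (a - b) + b by omega, pow_add]
      simp [AlgEquiv.mul_apply]
    rw [h2] at h1
    rw [inv_inv, mul_assoc, h1, ← mul_assoc, Units.inv_mul, one_mul]

open Classical in
/-- A subgroup of `S ^ q` which is closed under left multiplications and under right multiplications
twisted by the powers of `τ` contains a standard basis vector, unless it vanishes. -/
theorem HasInnerOrder.exists_single_mem [IsSimpleRing S] {τ : S ≃ₐ[F] S} {q : ℕ}
    (hτ : HasInnerOrder τ q) (V : AddSubgroup (Fin q → S))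
    (left : ∀ v ∈ V, ∀ s, (fun i => s * v i) ∈ V)
    (right : ∀ v ∈ V, ∀ s, (fun i : Fin q => v i * (τ ^ (i : ℕ)) s) ∈ V)
    {v : Fin q → S} (hv : v ∈ V) (hv0 : v ≠ 0) : ∃ i, Pi.single i 1 ∈ V := by
  obtain ⟨w, hw, i₀, h1, h⟩ := exists_normalized_mem_of_twisted_bimodule
    (fun i : Fin q => (τ ^ (i : ℕ)).toRingEquiv) V left right hv hv0
  refine ⟨i₀, ?_⟩
  convert! hw using 1
  funext i
  by_cases hi : i = i₀
  · subst hi; simp [h1]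
  · rw [Pi.single_eq_of_ne hi]
    exact (hτ.eq_zero_of_normal i.2 i₀.2 (fun h => hi (Fin.ext h)) (h i)).symm

/-- The evaluation at `t` of left polynomials of degree less than `q`. -/
def twistedEval (j : S →ₐ[F] B) (q : ℕ) (t : B) : (Fin q → S) →ₗ[F] B where
  toFun b := ∑ i, j (b i) * t ^ (i : ℕ)
  map_add' x y := by simp [add_mul, Finset.sum_add_distrib]
  map_smul' r x := by simp [Finset.smul_sum]

theorem twistedEval_apply (j : S →ₐ[F] B) (q : ℕ) (t : B) (b : Fin q → S) :
    twistedEval j q t b = ∑ i, j (b i) * t ^ (i : ℕ) := rfl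

/-- With `twistedEval_right`, this makes the preimage of a two-sided ideal a twisted sub-bimodule,
to which `HasInnerOrder.exists_single_mem` applies. -/
theorem twistedEval_left (j : S →ₐ[F] B) (q : ℕ) (t : B) (b : Fin q → S) (s : S) :
    twistedEval j q t (fun i => s * b i) = j s * twistedEval j q t b := by
  simp [twistedEval_apply, Finset.mul_sum, mul_assoc]

theorem twistedEval_right {j : S →ₐ[F] B} {τ : S ≃ₐ[F] S} {t : B}
    (comm : ∀ s, t * j s = j (τ s) * t) (q : ℕ) (b : Fin q → S) (s : S) :
    twistedEval j q t (fun i => b i * (τ ^ (i : ℕ)) s) = twistedEval j q t b * j s := by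
  simp only [twistedEval_apply, Finset.sum_mul, mul_assoc, map_mul, pow_mul_of_twisted comm]

theorem twistedEval_single (j : S →ₐ[F] B) (q : ℕ) (t : B) (i : Fin q) (s : S) :
    twistedEval j q t (Pi.single i s) = j s * t ^ (i : ℕ) := by
  rw [twistedEval_apply, Finset.sum_eq_single i]
  · simp
  · intro k _ hk; simp [Pi.single_eq_of_ne hk]
  · simp

/-- The powers of a unit inducing an automorphism of inner order `q` on a simple subring are
linearly independent up to the exponent `q - 1`. -/
theorem HasInnerOrder.twistedEval_injective [IsSimpleRing S] [Nontrivial B] {j : S →ₐ[F] B}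
    {τ : S ≃ₐ[F] S} {q : ℕ} (hτ : HasInnerOrder τ q) {t : B} (comm : ∀ s, t * j s = j (τ s) * t)
    (ht : IsUnit t) : Function.Injective (twistedEval j q t) := by
  rw [injective_iff_map_eq_zero]
  intro v hv
  by_contra h0
  obtain ⟨i, hi⟩ := hτ.exists_single_mem (LinearMap.ker (twistedEval j q t)).toAddSubgroup
    (fun v hv s => by
      simp only [Submodule.mem_toAddSubgroup, LinearMap.mem_ker] at hv ⊢
      rw [twistedEval_left, hv, mul_zero])
    (fun v hv s => by
      simp only [Submodule.mem_toAddSubgroup, LinearMap.mem_ker] at hv ⊢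
      rw [twistedEval_right comm, hv, zero_mul]) (v := v) hv h0
  simp only [Submodule.mem_toAddSubgroup, LinearMap.mem_ker, twistedEval_single, map_one,
    one_mul] at hi
  exact (ht.pow _).ne_zero hi

namespace IsTwistedExtension

variable {j : S →ₐ[F] B} {τ : S ≃ₐ[F] S} {q : ℕ} {t : B}

theorem nontrivial [Nontrivial S] (h : IsTwistedExtension j τ q t) (hq : 0 < q) :
    Nontrivial B := by
  have : Nonempty (Fin q) := ⟨⟨0, hq⟩⟩
  exact h.bijective.1.nontrivial

/-- The preimage of a nonzero ideal contains a standard basis vector, so the ideal contains some `t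
^ i`, a unit. -/
theorem isSimpleRing [IsSimpleRing S] (h : IsTwistedExtension j τ q t)
    (hτ : HasInnerOrder τ q) : IsSimpleRing B := by
  have := h.nontrivial hτ.1.1
  refine isSimpleRing_of_exists_isUnit fun I a ha ha0 => ?_
  obtain ⟨v, rfl⟩ := h.bijective.2 a
  let V : AddSubgroup (Fin q → S) :=
    { carrier := {v | twistedEval j q t v ∈ I}
      zero_mem' := by simp [I.zero_mem]
      add_mem' := fun {p q} hp hq => by simpa using I.add_mem hp hq
      neg_mem' := fun {p} hp => by simpa using I.neg_mem hp }
  obtain ⟨i, hi⟩ := hτ.exists_single_mem V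
    (fun v hv s => by
      change _ ∈ I
      rw [twistedEval_left]
      exact I.mul_mem_left _ _ hv)
    (fun v hv s => by
      change _ ∈ I
      rw [twistedEval_right h.comm]
      exact I.mul_mem_right _ _ hv) (v := v) ha (by rintro rfl; simp at ha0)
  refine ⟨_, hi, ?_⟩
  simpa [twistedEval_single] using h.isUnit.pow _

theorem map_injective (h : IsTwistedExtension j τ q t) (hq : 0 < q) : Function.Injective j := by
  intro x y hxy
  have : (Pi.single ⟨0, hq⟩ x : Fin q → S) = Pi.single ⟨0, hq⟩ y := by
    apply h.bijective.1
    change twistedEval j q t _ = twistedEval j q t _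
    rw [twistedEval_single, twistedEval_single, hxy]
  simpa using congrFun this ⟨0, hq⟩

/-- The center of a twisted extension consists of the fixed points of the automorphism on the center
of the base. -/
theorem mem_center_iff [IsSimpleRing S] (h : IsTwistedExtension j τ q t)
    (hτ : HasInnerOrder τ q) (z : B) :
    z ∈ Subalgebra.center F B ↔ ∃ s ∈ Subalgebra.center F S, τ s = s ∧ j s = z := by
  have := h.nontrivial hτ.1.1
  have hq := hτ.1.1
  constructor
  · intro hz
    rw [Subalgebra.mem_center_iff] at hz
    obtain ⟨v, hv : twistedEval j q t v = z⟩ := h.bijective.2 z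
    -- Comparing the coefficients of `s z = z s`; normality then kills every coefficient but the
    -- constant one.
    have hcomm : ∀ i s, s * v i = v i * (τ ^ (i : ℕ)) s := by
      intro i s
      have h1 : twistedEval j q t (fun i => s * v i) =
          twistedEval j q t (fun i => v i * (τ ^ (i : ℕ)) s) := by
        rw [twistedEval_left, twistedEval_right h.comm, hv, hz]
      exact congrFun (h.bijective.1 h1) i
    have hz0 : z = j (v ⟨0, hq⟩) := by
      rw [← hv, twistedEval_apply, Finset.sum_eq_single ⟨0, hq⟩]
      · simp
      · intro i _ hi
        rw [hτ.eq_zero_of_normal i.2 hq (fun h => hi (Fin.ext h)) (w := v i)]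
        · simp
        · intro s; exact hcomm i s
      · simp
    refine ⟨v ⟨0, hq⟩, Subalgebra.mem_center_iff.2 fun s => by simpa using hcomm ⟨0, hq⟩ s,
      ?_, hz0.symm⟩
    -- Commuting with `t` forces the constant coefficient to be fixed by `τ`.
    have := hz t
    rw [hz0, h.comm] at this
    exact h.map_injective hq (h.isUnit.mul_right_cancel this)
  · rintro ⟨s, hs, hτs, rfl⟩
    rw [Subalgebra.mem_center_iff] at hs ⊢
    have ht : ∀ n : ℕ, t ^ n * j s = j s * t ^ n := fun n => by
      rw [pow_mul_of_twisted h.comm]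
      congr 2
      induction n with
      | zero => rfl
      | succ n ih => rw [pow_succ, AlgEquiv.mul_apply, hτs, ih]
    intro b
    obtain ⟨v, rfl⟩ := h.bijective.2 b
    simp only [Finset.sum_mul, Finset.mul_sum, mul_assoc, ht]
    refine Finset.sum_congr rfl fun i _ => ?_
    rw [← mul_assoc, ← mul_assoc, ← map_mul, ← map_mul, hs]

end IsTwistedExtension

end TwistedExtensions

/-! ### Division by `t ^ q - c` and twisted quotients -/

section TwistedPolynomials

variable {F S B : Type*} [Field F] [Ring S] [Algebra F S] [Ring B] [Algebra F B]

open SkewPolynomial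

theorem twistAction_smul (τ : S ≃ₐ[F] S) (n : ℕ) (s : S) :
    letI := twistAction τ
    Multiplicative.ofAdd n • s = (τ ^ n) s := rfl

theorem twist_monomial_mul_monomial (τ : S ≃ₐ[F] S) (n m : ℕ) (a b : S) :
    letI := twistAction τ
    (monomial n a * monomial m b : SkewPolynomial S) = monomial (n + m) (a * (τ ^ n) b) := by
  let := twistAction τ
  rw [monomial_mul_monomial, φ_iterate_apply, twistAction_smul]

theorem twistedBinomial_eq (τ : S ≃ₐ[F] S) (q : ℕ) (c : S) :
    twistedBinomial τ q c = monomial q 1 - monomial 0 c := by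
  let := twistAction τ
  rw [monomial_one_right_eq_X_pow]; rfl

theorem monomial_mul_twistedBinomial (τ : S ≃ₐ[F] S) (q : ℕ) (c : S) (n : ℕ) (a : S) :
    letI := twistAction τ
    monomial n a * twistedBinomial τ q c = monomial (n + q) a - monomial n (a * (τ ^ n) c) := by
  let := twistAction τ
  rw [twistedBinomial_eq, mul_sub, twist_monomial_mul_monomial, twist_monomial_mul_monomial,
    map_one, mul_one, add_zero]

theorem twistedBinomial_mul_monomial (τ : S ≃ₐ[F] S) (q : ℕ) (c : S) (n : ℕ) (a : S) :
    letI := twistAction τ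
    twistedBinomial τ q c * monomial n a = monomial (q + n) ((τ ^ q) a) - monomial n (c * a) := by
  let := twistAction τ
  rw [twistedBinomial_eq, sub_mul, twist_monomial_mul_monomial, twist_monomial_mul_monomial,
    one_mul, zero_add]
  rfl

theorem coeff_mul_twistedBinomial (τ : S ≃ₐ[F] S) (q : ℕ) (c : S) (p : SkewPolynomial S) (n : ℕ) :
    letI := twistAction τ
    (p * twistedBinomial τ q c).coeff (n + q) =
      p.coeff n - p.coeff (n + q) * (τ ^ (n + q)) c := by
  let := twistAction τ
  induction p using SkewPolynomial.induction with
  | h0 => simp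
  | ha m r p _ _ ih =>
    rw [add_mul, coeff_add, ih, monomial_mul_twistedBinomial, coeff_sub, coeff_add, coeff_add,
      coeff_monomial, coeff_monomial, coeff_monomial, coeff_monomial, add_mul]
    by_cases h : m = n + q
    · subst h; simp; abel
    · simp [h]; abel

theorem SkewDegreeLT.add {q : ℕ} {f g : SkewPolynomial S} (hf : SkewDegreeLT q f)
    (hg : SkewDegreeLT q g) : SkewDegreeLT q (f + g) := fun n hn => by
  rw [coeff_add, hf n hn, hg n hn, add_zero]

theorem SkewDegreeLT.sub {q : ℕ} {f g : SkewPolynomial S} (hf : SkewDegreeLT q f)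
    (hg : SkewDegreeLT q g) : SkewDegreeLT q (f - g) := fun n hn => by
  rw [coeff_sub, hf n hn, hg n hn, sub_zero]

theorem skewDegreeLT_zero (q : ℕ) : SkewDegreeLT q (0 : SkewPolynomial S) := fun n _ => coeff_zero n

theorem skewDegreeLT_monomial {q n : ℕ} (h : n < q) (a : S) : SkewDegreeLT q (monomial n a) :=
  fun m hm => by rw [coeff_monomial, if_neg (by omega)]

theorem exists_skewDegreeLT (g : SkewPolynomial S) : ∃ N, SkewDegreeLT N g := by
  refine ⟨g.support.sup id + 1, fun n hn => notMem_support_iff.1 fun h => ?_⟩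
  have := Finset.le_sup (f := id) h
  simp only [id] at this
  omega

/-- A nonzero left multiple of `t ^ q - c` has degree at least `q`. -/
theorem eq_zero_of_mul_twistedBinomial {τ : S ≃ₐ[F] S} {q : ℕ} (hq : 0 < q) {c : S}
    {p : SkewPolynomial S}
    (h : letI := twistAction τ; SkewDegreeLT q (p * twistedBinomial τ q c)) : p = 0 := by
  -- Each coefficient is a multiple of the one `q` places higher, so all vanish by descent from the
  -- top.
  have hp : ∀ n, p.coeff n = p.coeff (n + q) * (τ ^ (n + q)) c := fun n => by
    have := h (n + q) (by omega)
    rwa [coeff_mul_twistedBinomial, sub_eq_zero] at this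
  obtain ⟨N, hN⟩ := exists_skewDegreeLT p
  have key : ∀ k n, N ≤ n + k → p.coeff n = 0 := by
    intro k
    induction k with
    | zero => exact fun n hn => hN n hn
    | succ k ih => intro n hn; rw [hp, ih (n + q) (by omega), zero_mul]
  exact SkewPolynomial.ext fun n => key N n (by omega)

theorem exists_eq_mul_twistedBinomial_add (τ : S ≃ₐ[F] S) {q : ℕ} (hq : 0 < q) (c : S)
    (g : SkewPolynomial S) :
    letI := twistAction τ
    ∃ p r, SkewDegreeLT q r ∧ g = p * twistedBinomial τ q c + r := by
  let := twistAction τ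
  induction g using SkewPolynomial.induction with
  | h0 => exact ⟨0, 0, skewDegreeLT_zero q, by simp⟩
  | ha n a g _ _ ih =>
    obtain ⟨p, r, hr, rfl⟩ := ih
    obtain ⟨p', r', hr', h⟩ : ∃ p r, SkewDegreeLT q r ∧
        monomial n a = p * twistedBinomial τ q c + r := by
      clear * - hq
      induction n using Nat.strong_induction_on generalizing a with
      | _ n ih =>
        by_cases hn : n < q
        · exact ⟨0, _, skewDegreeLT_monomial hn a, by simp⟩
        · obtain ⟨p, r, hr, h⟩ := ih (n - q) (by omega) (a * (τ ^ (n - q)) c)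
          refine ⟨monomial (n - q) a + p, r, hr, ?_⟩
          rw [add_mul, add_assoc, ← h, monomial_mul_twistedBinomial, Nat.sub_add_cancel (by omega),
            sub_add_cancel]
    exact ⟨p' + p, r' + r, hr'.add hr, by rw [h, add_mul]; abel⟩

/-- On monomials, `(t ^ q - c) a t ^ n = τ ^ q (a) t ^ n (t ^ q - c)`. -/
theorem isRightInvariant_twistedBinomial {τ : S ≃ₐ[F] S} {q : ℕ} {c : S} (hτc : τ c = c)
    (hc : ∀ s, c * s = (τ ^ q) s * c) : IsRightInvariant τ (twistedBinomial τ q c) := by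
  let := twistAction τ
  have hfix : ∀ n : ℕ, (τ ^ n) c = c := fun n => by
    induction n with
    | zero => rfl
    | succ n ih => rw [pow_succ, AlgEquiv.mul_apply, hτc, ih]
  intro g
  induction g using SkewPolynomial.induction with
  | h0 => exact ⟨0, by simp⟩
  | ha n a g _ _ ih =>
    obtain ⟨h, hh⟩ := ih
    refine ⟨monomial n ((τ ^ q) a) + h, ?_⟩
    rw [mul_add, add_mul, hh, twistedBinomial_mul_monomial, monomial_mul_twistedBinomial, hfix, hc,
      add_comm q n]

theorem smul_skewMonomial (n : ℕ) (r : F) (s : S) :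
    r • (monomial n s : SkewPolynomial S) = monomial n (r • s) :=
  SkewMonoidAlgebra.smul_single _ _ _

variable (F) in
/-- The twisted polynomial of degree less than `q` with given coefficients. -/
noncomputable def skewOfFin (q : ℕ) : (Fin q → S) →ₗ[F] SkewPolynomial S where
  toFun b := ∑ i : Fin q, monomial (i : ℕ) (b i)
  map_add' x y := by simp [Finset.sum_add_distrib]
  map_smul' r x := by
    simp only [Finset.smul_sum, Pi.smul_apply, RingHom.id_apply, smul_skewMonomial]

theorem skewOfFin_apply (q : ℕ) (b : Fin q → S) :
    skewOfFin F q b = ∑ i : Fin q, monomial (i : ℕ) (b i) := rfl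

theorem coeff_skewOfFin (q : ℕ) (b : Fin q → S) (n : ℕ) :
    (skewOfFin F q b).coeff n = if hn : n < q then b ⟨n, hn⟩ else 0 := by
  classical
  have hadd : ∀ s : Finset (Fin q), (∑ i ∈ s, monomial (i : ℕ) (b i) : SkewPolynomial S).coeff n =
      ∑ i ∈ s, (monomial (i : ℕ) (b i)).coeff n := fun s => by
    induction s using Finset.induction_on with
    | empty => simp
    | insert i s hi ih => rw [Finset.sum_insert hi, Finset.sum_insert hi, coeff_add, ih]
  rw [skewOfFin_apply, hadd]
  simp only [coeff_monomial]
  split_ifs with hn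
  · rw [Finset.sum_eq_single ⟨n, hn⟩]
    · simp
    · intro i _ hi; rw [if_neg fun h => hi (Fin.ext h)]
    · simp
  · exact Finset.sum_eq_zero fun i _ => if_neg fun h : (i : ℕ) = n => hn (h ▸ i.2)

theorem range_skewOfFin (q : ℕ) :
    Set.range (skewOfFin F q : (Fin q → S) → SkewPolynomial S) = {g | SkewDegreeLT q g} := by
  ext g
  constructor
  · rintro ⟨b, rfl⟩ n hn
    rw [coeff_skewOfFin, dif_neg (by omega)]
  · intro hg
    refine ⟨fun i => g.coeff i, SkewPolynomial.ext fun n => ?_⟩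
    rw [coeff_skewOfFin]
    split_ifs with hn
    · rfl
    · exact (hg n (by omega)).symm

theorem skewOfFin_injective (q : ℕ) :
    Function.Injective (skewOfFin F q : (Fin q → S) → SkewPolynomial S) := fun x y h => by
  funext i
  have := congrArg (fun g => SkewPolynomial.coeff g i) h
  simpa [coeff_skewOfFin] using this

theorem skewOfFin_single {q : ℕ} (i : Fin q) (s : S) :
    skewOfFin F q (Pi.single i s) = monomial (i : ℕ) s := by
  rw [skewOfFin_apply, Finset.sum_eq_single i]
  · simp
  · intro k _ hk; simp [Pi.single_eq_of_ne hk]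
  · simp

section OfQuotient

variable {τ : S ≃ₐ[F] S} {q : ℕ} {c : S} {φ : B →ₗ[F] SkewPolynomial S}

/-- No reduction occurs: the difference would be a left multiple of `t ^ q - c` of degree less than
`q`, hence zero. -/
theorem IsTwistedQuotientIso.map_mul_of_skewDegreeLT
    (h : IsTwistedQuotientIso τ (twistedBinomial τ q c) q φ) (hq : 0 < q) {x y : B}
    {g : SkewPolynomial S} (hg : letI := twistAction τ; φ x * φ y = g) (hd : SkewDegreeLT q g) :
    φ (x * y) = g := by
  let := twistAction τ
  obtain ⟨p, hp⟩ := h.map_mul x y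
  have hxy : SkewDegreeLT q (φ (x * y)) := by
    have : φ (x * y) ∈ Set.range φ := ⟨_, rfl⟩
    rwa [h.range_eq] at this
  have hp0 : p = 0 := by
    refine eq_zero_of_mul_twistedBinomial (τ := τ) (c := c) hq ?_
    rw [show p * twistedBinomial τ q c = g - φ (x * y) by rw [← hg, hp]; abel]
    exact hd.sub hxy
  rw [← hg, hp, hp0, zero_mul, zero_add]

/-- The quotient of a twisted polynomial ring by `t ^ q - c` is a twisted extension. -/
theorem IsTwistedQuotientIso.exists_isTwistedExtension
    (h : IsTwistedQuotientIso τ (twistedBinomial τ q c) q φ) (hq : 1 < q) (hc : IsUnit c) :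
    ∃ (j : S →ₐ[F] B) (t : B), IsTwistedExtension j τ q t := by
  let := twistAction τ
  have hex : ∀ g, SkewDegreeLT q g → ∃ x, φ x = g := fun g hg => by
    have : g ∈ Set.range φ := by rw [h.range_eq]; exact hg
    exact this
  have hq0 : 0 < q := by omega
  choose j₀ hj using fun s : S => hex (monomial 0 s) (skewDegreeLT_monomial hq0 s)
  -- The indeterminate itself is a reduced representative only because `1 < q`.
  obtain ⟨t, ht⟩ := hex (monomial 1 1) (skewDegreeLT_monomial hq 1)
  have hone : (1 : SkewPolynomial S) = monomial 0 1 := rfl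
  let j : S →ₐ[F] B :=
    { toFun := j₀
      map_one' := h.injective (by rw [hj, h.map_one]; rfl)
      map_mul' := fun x y => h.injective (by
        rw [hj, h.map_mul_of_skewDegreeLT hq0 _ (skewDegreeLT_monomial hq0 (x * y))]
        rw [hj, hj, twist_monomial_mul_monomial]; rfl)
      map_zero' := h.injective (by rw [hj, _root_.map_zero, _root_.map_zero])
      map_add' := fun x y => h.injective (by rw [hj, map_add, map_add, hj, hj])
      commutes' := fun r => h.injective (by
        rw [hj, Algebra.algebraMap_eq_smul_one, Algebra.algebraMap_eq_smul_one, LinearMap.map_smul, h.map_one,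
          hone]
        exact (SkewMonoidAlgebra.smul_single _ _ _).symm) }
  have hj' : ∀ s, φ (j s) = monomial 0 s := hj
  have hpow : ∀ n, n < q → ∀ s, φ (j s * t ^ n) = monomial n s := by
    intro n
    induction n with
    | zero => intro _ s; rw [pow_zero, mul_one, hj']
    | succ n ih =>
      intro hn s
      rw [pow_succ, ← mul_assoc]
      refine h.map_mul_of_skewDegreeLT hq0 ?_ (skewDegreeLT_monomial hn s)
      rw [ih (by omega), ht, twist_monomial_mul_monomial, _root_.map_one, mul_one]
  -- `t ^ (q - 1) * t` is the first product of powers that needs reduction: the quotient is `1` and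
  -- the remainder is `c`.
  have htq : t ^ q = j c := by
    apply h.injective
    obtain ⟨p, hp⟩ := h.map_mul (t ^ (q - 1)) t
    have h1 := hpow (q - 1) (by omega) 1
    rw [_root_.map_one, one_mul] at h1
    rw [h1, ht, twist_monomial_mul_monomial, _root_.map_one, mul_one, ← pow_succ,
      Nat.sub_add_cancel (by omega)] at hp
    have hd : SkewDegreeLT q (φ (t ^ q)) := by
      have : φ (t ^ q) ∈ Set.range φ := ⟨_, rfl⟩
      rwa [h.range_eq] at this
    have h2 : (p - 1) * twistedBinomial τ q c = monomial 0 c - φ (t ^ q) := by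
      rw [sub_mul, one_mul]
      nth_rewrite 2 [twistedBinomial_eq]
      rw [hp]; abel
    have h3 : p - 1 = 0 := by
      refine eq_zero_of_mul_twistedBinomial (τ := τ) (c := c) hq0 ?_
      rw [h2]
      exact (skewDegreeLT_monomial hq0 c).sub hd
    rw [h3, zero_mul] at h2
    rw [hj', ← sub_eq_zero.1 h2.symm]
  have hsum : ∀ b : Fin q → S, φ (∑ i, j (b i) * t ^ (i : ℕ)) = skewOfFin F q b := fun b => by
    rw [map_sum]
    exact Finset.sum_congr rfl fun i _ => hpow (i : Fin q) i.2 (b i)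
  refine ⟨j, t, ⟨fun s => h.injective ?_, ?_, fun x y hxy => ?_, fun x => ?_⟩⟩
  · rw [← pow_one t, hpow 1 hq, pow_one]
    refine h.map_mul_of_skewDegreeLT hq0 ?_ (skewDegreeLT_monomial hq _)
    rw [ht, hj', twist_monomial_mul_monomial, one_mul]; rfl
  · rw [← isUnit_pow_iff (n := q) (by omega), htq]
    exact hc.map j
  · apply skewOfFin_injective (F := F)
    rw [← hsum, ← hsum]
    exact congrArg φ hxy
  · obtain ⟨b, hb⟩ : φ x ∈ Set.range (skewOfFin F q : (Fin q → S) → SkewPolynomial S) := by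
      rw [range_skewOfFin, ← h.range_eq]; exact ⟨x, rfl⟩
    exact ⟨b, h.injective ((hsum b).trans hb)⟩

end OfQuotient

/-- A twisted extension in which `t ^ q` lies in the base is a quotient of a twisted polynomial
ring, by an isomorphism which is the identity on the base. -/
theorem IsTwistedExtension.exists_isTwistedQuotientIso {j : S →ₐ[F] B} {τ : S ≃ₐ[F] S} {q : ℕ}
    {t : B} (h : IsTwistedExtension j τ q t) (hq : 0 < q) {c : S} (htq : t ^ q = j c) :
    ∃ φ : B →ₗ[F] SkewPolynomial S, IsTwistedQuotientIso τ (twistedBinomial τ q c) q φ ∧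
      ∀ s, φ (j s) = C s := by
  let := twistAction τ
  let e : (Fin q → S) ≃ₗ[F] B := LinearEquiv.ofBijective (twistedEval j q t) h.bijective
  let φ : B →ₗ[F] SkewPolynomial S := (skewOfFin F q).comp e.symm.toLinearMap
  have hj : ∀ s, φ (j s) = C s := fun s => by
    have h1 : e.symm (j s) = Pi.single ⟨0, hq⟩ s := by
      rw [LinearEquiv.symm_apply_eq]
      exact (by simp [twistedEval_single] : j s = twistedEval j q t (Pi.single ⟨0, hq⟩ s))
    change skewOfFin F q (e.symm (j s)) = _
    rw [h1, skewOfFin_single]; rfl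
  -- Evaluation at `t` is a ring homomorphism that kills `t ^ q - c` and inverts `φ`, so the
  -- remainder of `φ x * φ y` can only be `φ (x * y)`.
  let ev : SkewPolynomial S →+* B := SkewMonoidAlgebra.liftNCRingHom (j : S →+* B)
    (powersHom B t) (fun {x y} => (pow_mul_of_twisted h.comm y.toAdd x).symm)
  have hev : ∀ n s, ev (monomial n s) = j s * t ^ n := fun n s =>
    SkewMonoidAlgebra.liftNC_single _ _ _ _
  have hevφ : ∀ x, ev (φ x) = x := fun x => by
    obtain ⟨b, rfl⟩ := e.surjective x
    change ev (skewOfFin F q (e.symm (e b))) = twistedEval j q t b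
    rw [LinearEquiv.symm_apply_apply, skewOfFin_apply, map_sum]
    simp only [hev, twistedEval_apply]
  have hrange : Set.range φ = {g | SkewDegreeLT q g} := by
    rw [← range_skewOfFin (F := F)]
    exact e.symm.surjective.range_comp (skewOfFin F q)
  refine ⟨φ, ⟨(skewOfFin_injective (F := F) q).comp e.symm.injective, hrange, ?_, fun x y => ?_⟩, hj⟩
  · rw [← map_one j, hj]; rfl
  · obtain ⟨p, r, hr, hpr⟩ := exists_eq_mul_twistedBinomial_add τ hq c (φ x * φ y)
    obtain ⟨z, rfl⟩ : r ∈ Set.range φ := by rw [hrange]; exact hr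
    have := congrArg ev hpr
    rw [map_mul, hevφ, hevφ, map_add, map_mul, twistedBinomial_eq, map_sub, hev, hev, hevφ, map_one,
      one_mul, htq, pow_zero, mul_one, sub_self, mul_zero, zero_add] at this
    exact ⟨p, by rw [hpr, this]⟩

end TwistedPolynomials

/-! ### Perfect subgroups -/

section PerfectSubgroups

variable {Γ : Type*} [Group Γ]

/-- The perfect subgroups of a group which are contained in the subgroup `P`. -/
def perfectSubgroups (P : Subgroup Γ) : Set (Subgroup Γ) := {H | H ≤ P ∧ ⁅H, H⁆ = H}

theorem perfectSubgroups_mono {P Q : Subgroup Γ} (h : P ≤ Q) :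
    perfectSubgroups P ⊆ perfectSubgroups Q := fun _ hH => ⟨hH.1.trans h, hH.2⟩

/-- A perfect `H ≤ Q` satisfies `H = ⁅H, H⁆ ≤ ⁅Q, Q⁆ ≤ P`. -/
theorem perfectSubgroups_eq_of_commutator_le {P Q : Subgroup Γ} (h : P ≤ Q) (hQ : ⁅Q, Q⁆ ≤ P) :
    perfectSubgroups Q = perfectSubgroups P :=
  Set.Subset.antisymm
    (fun _ hH => ⟨hH.2 ▸ (Subgroup.commutator_mono hH.1 hH.1).trans hQ, hH.2⟩)
    (perfectSubgroups_mono h)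

open scoped Pointwise in
theorem ncard_perfectSubgroups_conj (g : Γ) (P : Subgroup Γ) :
    (perfectSubgroups (MulAut.conj g • P)).ncard = (perfectSubgroups P).ncard := by
  have : perfectSubgroups (MulAut.conj g • P) =
      (fun H : Subgroup Γ => MulAut.conj g • H) '' perfectSubgroups P := by
    have key : ∀ (a : MulAut Γ) (Q H : Subgroup Γ), H ∈ perfectSubgroups Q →
        a • H ∈ perfectSubgroups (a • Q) := fun a Q H hH => by
      refine ⟨Subgroup.pointwise_smul_le_pointwise_smul_iff.2 hH.1, ?_⟩
      conv_rhs => rw [← hH.2]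
      exact (Subgroup.map_commutator _ _ _).symm
    ext H
    constructor
    · intro hH
      exact ⟨(MulAut.conj g)⁻¹ • H, by simpa using key (MulAut.conj g)⁻¹ _ _ hH, by simp⟩
    · rintro ⟨H, hH, rfl⟩
      exact key _ _ _ hH
  rw [this, Set.ncard_image_of_injective _ (MulAction.injective _)]

theorem exists_derivedSeries_commutator_eq_self (G : Type*) [Group G] [Finite G] :
    ∃ m, ⁅derivedSeries G m, derivedSeries G m⁆ = derivedSeries G m := by
  obtain ⟨m, hm⟩ := WellFoundedLT.antitone_chain_condition (f := derivedSeries G)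
    (derivedSeries_antitone G)
  exact ⟨m, (hm (m + 1) (Nat.le_succ m)).symm⟩

end PerfectSubgroups

/-! ### Perfect subgroups of fixing groups -/

section Fields

variable {F N : Type*} [Field F] [Field N] [Algebra F N]

open IntermediateField

/-- An automorphism over the fixed field of an automorphism `τ` of a subfield acts on the subfield
as a power of `τ`. -/
theorem exists_zpow_of_mem_fixingSubgroup_lift [FiniteDimensional F N]
    (L : IntermediateField F N) (τ : L ≃ₐ[F] L) {g : N ≃ₐ[F] N}
    (hg : g ∈ (lift (fixedField (Subgroup.zpowers τ))).fixingSubgroup) :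
    ∃ ρ ∈ Subgroup.zpowers τ, ∀ x : L, g x = (ρ x : N) := by
  let K : IntermediateField F L := fixedField (Subgroup.zpowers τ)
  -- Normality of `L` over `K` lets `g` restrict to `L`; by the Galois correspondence the
  -- restriction lies in the group generated by `τ`.
  have : IsGalois K L := IsGalois.of_fixed_field L (Subgroup.zpowers τ)
  let gK : N ≃ₐ[K] N :=
    { g with
      commutes' := fun r => hg ⟨((r : L) : N), (mem_lift (r : L)).2 r.2⟩ }
  let ρ : L ≃ₐ[K] L := gK.restrictNormal L
  refine ⟨ρ.restrictScalars F, ?_, fun x => (gK.restrictNormal_commutes L x).symm⟩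
  rw [← fixingSubgroup_fixedField (Subgroup.zpowers τ)]
  rintro ⟨x, hx⟩
  exact ρ.commutes ⟨x, hx⟩

/-- Both elements act on `L` as powers of `τ`, so their actions on `L` commute. -/
theorem commutator_fixingSubgroup_lift_le [FiniteDimensional F N]
    (L : IntermediateField F N) (τ : L ≃ₐ[F] L) :
    ⁅(lift (fixedField (Subgroup.zpowers τ))).fixingSubgroup,
      (lift (fixedField (Subgroup.zpowers τ))).fixingSubgroup⁆ ≤ L.fixingSubgroup := by
  rw [Subgroup.commutator_le]
  intro g hg h hh
  rw [IntermediateField.mem_fixingSubgroup_iff]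
  intro x hx
  obtain ⟨ρ, ⟨a, rfl⟩, hρ⟩ := exists_zpow_of_mem_fixingSubgroup_lift L τ hg
  obtain ⟨ρ', ⟨b, rfl⟩, hρ'⟩ := exists_zpow_of_mem_fixingSubgroup_lift L τ hh
  simp only at hρ hρ'
  obtain ⟨y, hy⟩ : ∃ y : L, (τ ^ b) ((τ ^ a) y) = ⟨x, hx⟩ :=
    ⟨(τ ^ a).symm ((τ ^ b).symm ⟨x, hx⟩), by simp only [AlgEquiv.apply_symm_apply]⟩
  have h1 : (h * g) y = x := by rw [AlgEquiv.mul_apply, hρ, hρ', hy]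
  have h2 : (g * h) y = x := by
    rw [AlgEquiv.mul_apply, hρ', hρ, ← AlgEquiv.mul_apply, ← zpow_add, add_comm, zpow_add,
      AlgEquiv.mul_apply, hy]
  have h3 : g * h * g⁻¹ * h⁻¹ * (h * g) = g * h := by group
  rw [commutatorElement_def]
  conv_lhs => rw [← h1, ← AlgEquiv.mul_apply, h3, h2]

/-- This is the invariance that survives each step of a chain. -/
theorem perfectSubgroups_fixingSubgroup_lift [FiniteDimensional F N]
    (L : IntermediateField F N) (τ : L ≃ₐ[F] L) :
    perfectSubgroups (lift (fixedField (Subgroup.zpowers τ))).fixingSubgroup =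
      perfectSubgroups L.fixingSubgroup :=
  perfectSubgroups_eq_of_commutator_le (fixingSubgroup_le (lift_le _))
    (commutator_fixingSubgroup_lift_le L τ)

/-- The number of perfect subgroups of the fixing group only depends on the isomorphism class of an
intermediate field of a normal extension. -/
theorem ncard_perfectSubgroups_fixingSubgroup_congr [Normal F N] {L L' : IntermediateField F N}
    (e : L ≃ₐ[F] L') :
    (perfectSubgroups L'.fixingSubgroup).ncard = (perfectSubgroups L.fixingSubgroup).ncard := by
  -- By normality `e` extends to an automorphism of `N`, which conjugates one fixing group into the
  -- other.
  have : L' = L.map (e.liftNormal N : N →ₐ[F] N) := by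
    ext x
    rw [mem_map]
    constructor
    · intro hx
      exact ⟨e.symm ⟨x, hx⟩, (e.symm ⟨x, hx⟩).2, by
        have := e.liftNormal_commutes N (e.symm ⟨x, hx⟩)
        rwa [AlgEquiv.apply_symm_apply] at this⟩
    · rintro ⟨y, hy, rfl⟩
      have := e.liftNormal_commutes N ⟨y, hy⟩
      exact this ▸ (e ⟨y, hy⟩).2
  rw [this, IsGalois.map_fixingSubgroup, ncard_perfectSubgroups_conj]

/-- Let `M/K` be a Galois extension inside `N`.  If every perfect group of automorphisms of `N` over
`K` fixes `M`, then `Gal(M/K)` is solvable. -/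
theorem isSolvable_of_perfectSubgroups_subset {M : Type*} [Field M] [Algebra F M] [Algebra M N]
    [IsScalarTower F M N] [FiniteDimensional F N] [Normal F N] (K : IntermediateField F M)
    [Normal K M]
    (h : ∀ H : Subgroup (N ≃ₐ[F] N), ⁅H, H⁆ = H → (∀ g ∈ H, ∀ x ∈ K, g (algebraMap M N x) =
      algebraMap M N x) → ∀ g ∈ H, ∀ x, g (algebraMap M N x) = algebraMap M N x) :
    Group.IsSolvable (M ≃ₐ[K] M) := by
  have : Normal K N := Normal.tower_top_of_normal F K N
  have : FiniteDimensional K N := FiniteDimensional.right F K N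
  -- The stable term of the derived series is perfect, so it fixes `M`; restriction to `M` is
  -- surjective and maps it onto the `m`-th derived subgroup of `Gal(M/K)`.
  obtain ⟨m, hm⟩ := exists_derivedSeries_commutator_eq_self (N ≃ₐ[K] N)
  refine ⟨m, ?_⟩
  rw [← map_derivedSeries_eq (AlgEquiv.restrictNormalHom_surjective (F := K) (K₁ := M) N) m,
    eq_bot_iff]
  rintro _ ⟨g, hg, rfl⟩
  rw [Subgroup.mem_bot]
  have key := h ((derivedSeries (N ≃ₐ[K] N) m).map (AlgEquiv.restrictScalarsHom F))
    (by rw [← Subgroup.map_commutator, hm])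
    (by
      rintro _ ⟨g, _, rfl⟩ x hx
      exact g.commutes ⟨x, hx⟩) _ ⟨g, hg, rfl⟩
  ext x
  apply (algebraMap M N).injective
  exact (g.restrictNormal_commutes M x).trans (key x)

end Fields

/-! ### Centers along a chain -/

section CentersOfChains

variable {F N : Type*} [Field F] [Field N] [Algebra F N] [FiniteDimensional F N]

open IntermediateField

/-- The automorphism of the center induced by an automorphism. -/
noncomputable def centerAut {S : Type*} [Ring S] [Algebra F S] (τ : S ≃ₐ[F] S) :
    Subalgebra.center F S ≃ₐ[F] Subalgebra.center F S :=
  (τ.subalgebraMap (Subalgebra.center F S)).trans <| Subalgebra.equivOfEq _ _ <| by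
    ext x
    simp only [Subalgebra.mem_map, Subalgebra.mem_center_iff]
    constructor
    · rintro ⟨y, hy, rfl⟩ b
      obtain ⟨b, rfl⟩ := τ.surjective b
      change τ b * τ y = τ y * τ b
      rw [← map_mul, ← map_mul, hy]
    · intro hx
      refine ⟨τ.symm x, fun b => τ.injective ?_, τ.apply_symm_apply x⟩
      rw [map_mul, map_mul, τ.apply_symm_apply, hx]

/-- If the center of `S` is isomorphic to a subfield of `N`, so is the center of a twisted extension
of `S`, and the fixing groups of these subfields have the same perfect subgroups. -/
theorem IsTwistedExtension.exists_center_equiv {S B : Type*} [Ring S] [Algebra F S]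
    [IsSimpleRing S] [Ring B] [Algebra F B] {j : S →ₐ[F] B} {τ : S ≃ₐ[F] S} {q : ℕ} {t : B}
    (h : IsTwistedExtension j τ q t) (hτ : HasInnerOrder τ q) {L : IntermediateField F N}
    (e : L ≃ₐ[F] Subalgebra.center F S) :
    ∃ L' : IntermediateField F N, Nonempty (L' ≃ₐ[F] Subalgebra.center F B) ∧
      perfectSubgroups L'.fixingSubgroup = perfectSubgroups L.fixingSubgroup := by
  -- The action of `τ` on the center, transported to `L`; the new field is its fixed field, which
  -- `j` carries onto the center of `B`.
  let σ : L ≃ₐ[F] L := (e.trans (centerAut τ)).trans e.symm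
  let K := fixedField (Subgroup.zpowers σ)
  have hK : ∀ x : L, x ∈ K ↔ τ (e x) = e x := fun x => by
    have h1 : x ∈ K ↔ σ x = x := by
      rw [mem_fixedField_iff]
      refine ⟨fun hx => hx σ (Subgroup.mem_zpowers σ), fun hx f hf => ?_⟩
      have : Subgroup.zpowers σ ≤ MulAction.stabilizer (L ≃ₐ[F] L) x := by
        rw [Subgroup.zpowers_le]; exact hx
      exact this hf
    rw [h1]
    change e.symm (centerAut τ (e x)) = x ↔ _
    rw [AlgEquiv.symm_apply_eq, Subtype.ext_iff]
    rfl
  let f : K →ₐ[F] B := ((j.comp (Subalgebra.center F S).val).comp e.toAlgHom).comp K.val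
  have hf : ∀ x : K, f x = j (e x : S) := fun _ => rfl
  have hinj : Function.Injective f :=
    (h.map_injective hτ.1.1).comp (Subtype.val_injective.comp (e.injective.comp
      Subtype.val_injective))
  have hrange : f.range = Subalgebra.center F B := by
    ext z
    rw [h.mem_center_iff hτ]
    constructor
    · rintro ⟨x, rfl⟩
      exact ⟨e x, (e x).2, (hK x).1 x.2, rfl⟩
    · rintro ⟨s, hs, hτs, rfl⟩
      refine ⟨⟨e.symm ⟨s, hs⟩, (hK _).2 ?_⟩, ?_⟩
      · rw [AlgEquiv.apply_symm_apply]; exact hτs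
      · change j (e (e.symm ⟨s, hs⟩) : S) = j s
        rw [AlgEquiv.apply_symm_apply]
  exact ⟨lift K, ⟨(liftAlgEquiv K).symm.trans ((AlgEquiv.ofInjective f hinj).trans
    (Subalgebra.equivOfEq _ _ hrange))⟩, perfectSubgroups_fixingSubgroup_lift L σ⟩

end CentersOfChains

/-! ### A cyclic chain forces solvability -/

section Solvability

variable {F : Type u} {M : Type v} {A : Type w} [Field F] [Field M] [Algebra F M]
  [Ring A] [Algebra F A]

open IntermediateField

theorem isSimpleRing_range [Nontrivial A] (ι : M →ₐ[F] A) : IsSimpleRing ι.range := by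
  refine isSimpleRing_of_exists_isUnit ?_
  rintro I ⟨_, m, rfl⟩ ha ha0
  refine ⟨_, ha, ?_⟩
  have hm : m ≠ 0 := by rintro rfl; exact ha0 (Subtype.ext (map_zero ι))
  exact (IsUnit.mk0 m hm).map ι.rangeRestrict

theorem center_range_eq_top (ι : M →ₐ[F] A) : Subalgebra.center F ι.range = ⊤ := by
  rw [eq_top_iff]
  rintro ⟨_, m, rfl⟩ _
  rw [Subalgebra.mem_center_iff]
  rintro ⟨_, m', rfl⟩
  exact Subtype.ext (show ι m' * ι m = ι m * ι m' by rw [← map_mul, mul_comm, map_mul])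

/-- A field extension is Galois with solvable group over the common fixed field of its
automorphisms, if the latter is the center of the last algebra of a cyclic chain. -/
theorem IsCyclicChain.isSolvable [FiniteDimensional F M] [Nontrivial A] {ι : M →ₐ[F] A} {k : ℕ}
    {B : ℕ → Subalgebra F A} (h : IsCyclicChain ι k B)
    (hc : (Subalgebra.center F (B k)).map (B k).val =
      (fixedField (⊤ : Subgroup (M ≃ₐ[F] M))).toSubalgebra.map ι) :
    Group.IsSolvable (M ≃ₐ[F] M) := by
  let N := normalClosure F M (AlgebraicClosure M)
  let f : M →ₐ[F] N := IsScalarTower.toAlgHom F M N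
  -- The center is recorded only up to isomorphism, because the isomorphism of a step need not be
  -- the identity on the smaller algebra.
  let Good : Subalgebra F A → Prop := fun C => IsSimpleRing C ∧ ∃ L : IntermediateField F N,
    Nonempty (L ≃ₐ[F] Subalgebra.center F C) ∧
      perfectSubgroups L.fixingSubgroup = perfectSubgroups f.fieldRange.fixingSubgroup
  have hgood : ∀ i, i ≤ k → Good (B i) := by
    intro i
    induction i with
    | zero =>
      intro _
      rw [h.zero]
      refine ⟨isSimpleRing_range ι, f.fieldRange, ⟨?_⟩, rfl⟩
      exact (AlgEquiv.ofInjectiveField f).symm.trans <|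
        (AlgEquiv.ofInjective ι ι.toRingHom.injective).trans <|
        Subalgebra.topEquiv.symm.trans <| Subalgebra.equivOfEq _ _ (center_range_eq_top ι).symm
    | succ i ih =>
      intro hi
      obtain ⟨hs, L, ⟨e⟩, hL⟩ := ih (by omega)
      obtain ⟨q, τ, c, φ, hstep⟩ := h.step i (by omega)
      obtain ⟨j, t, ht⟩ := hstep.iso.exists_isTwistedExtension hstep.prime.one_lt hstep.isUnit
      obtain ⟨L', e', hL'⟩ := ht.exists_center_equiv hstep.innerOrder e
      exact ⟨ht.isSimpleRing hstep.innerOrder, L', e', hL'.trans hL⟩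
  obtain ⟨-, L, ⟨e⟩, hL⟩ := hgood k le_rfl
  let K := fixedField (⊤ : Subgroup (M ≃ₐ[F] M))
  have eK : L ≃ₐ[F] K.map f :=
    e.trans <| (Subalgebra.equivMapOfInjective _ (B k).val Subtype.val_injective).trans <|
      (Subalgebra.equivOfEq _ _ hc).trans <|
      (Subalgebra.equivMapOfInjective K.toSubalgebra ι ι.toRingHom.injective).symm.trans
      (K.equivMap f)
  have hle : K.map f ≤ f.fieldRange := by rintro _ ⟨x, _, rfl⟩; exact ⟨x, rfl⟩
  -- One inclusion is clear. The cardinalities agree because `L` is isomorphic to the image of `K`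
  -- and has the same perfect subgroups as `M`.
  have heq : perfectSubgroups f.fieldRange.fixingSubgroup =
      perfectSubgroups (K.map f).fixingSubgroup := by
    refine Set.eq_of_subset_of_ncard_le (perfectSubgroups_mono (fixingSubgroup_le hle)) ?_
      (Set.toFinite _)
    rw [← hL, ncard_perfectSubgroups_fixingSubgroup_congr eK]
  have : IsGalois K M := IsGalois.of_fixed_field M (⊤ : Subgroup (M ≃ₐ[F] M))
  have hsol : Group.IsSolvable (M ≃ₐ[K] M) := by
    refine isSolvable_of_perfectSubgroups_subset (F := F) (N := N) K fun H hH hK g hg x => ?_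
    have : H ∈ perfectSubgroups (K.map f).fixingSubgroup := by
      refine ⟨fun g hg => ?_, hH⟩
      rw [IntermediateField.mem_fixingSubgroup_iff]
      rintro _ ⟨x, hx, rfl⟩
      exact hK g hg x hx
    rw [← heq] at this
    exact (IntermediateField.mem_fixingSubgroup_iff _ _).1 (this.1 hg) _ ⟨x, rfl⟩
  have htop : fixingSubgroup K = ⊤ := fixingSubgroup_fixedField _
  let eG : (M ≃ₐ[K] M) ≃* (M ≃ₐ[F] M) :=
    (fixingSubgroupEquiv K).symm.trans ((MulEquiv.subgroupCongr htop).trans Subgroup.topEquiv)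
  exact Group.isSolvable_of_surjective (f := eG.toMonoidHom) eG.surjective

end Solvability

/-! ### Units inducing the Galois group -/

section CrossedProducts

variable {F : Type u} {M : Type v} {A : Type w} [Field F] [Field M] [Algebra F M] [FiniteDimensional F M]
  [Ring A] [Algebra F A]

open Polynomial IntermediateField

/-- If `A` is central simple and contains `M`, then every automorphism of the Galois extension `M/F`
is induced by a nonzero element of `A`. -/
theorem exists_ne_zero_semilinear [IsGalois F M] [IsSimpleRing A] [Algebra.IsCentral F A]
    (ι : M →ₐ[F] A) (σ : M ≃ₐ[F] M) : ∃ u : A, u ≠ 0 ∧ ∀ m, u * ι m = ι (σ m) * u := by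
  obtain ⟨θ, hθ⟩ := Field.exists_primitive_element F M
  have hint : IsIntegral F θ := IsIntegral.of_finite F θ
  let p : M[X] := (minpoly F θ).map (algebraMap F M)
  let := Module.compHom A (ι : M →+* A)
  have hsmul : ∀ (m : M) (a : A), m • a = ι m * a := fun _ _ => rfl
  -- Right multiplication by `θ`, linear for left multiplication by `M`. Writing the minimal
  -- polynomial as `(X - σ θ) r`, every value `u` of `r(T)` satisfies `u θ = σ(θ) u`; it remains to
  -- see that `r(T) ≠ 0`.
  let T : A →ₗ[M] A :=
    { toFun := fun a => a * ι θ
      map_add' := fun a b => add_mul a b _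
      map_smul' := fun m a => by simp only [hsmul, mul_assoc, RingHom.id_apply] }
  have hTpow : ∀ (n : ℕ) (a : A), (T ^ n) a = a * ι (θ ^ n) := fun n a => by
    induction n with
    | zero => simp
    | succ n ih =>
      rw [pow_succ', Module.End.mul_apply, ih]
      change a * ι (θ ^ n) * ι θ = _
      rw [mul_assoc, ← map_mul, pow_succ]
  have haeval : ∀ (r : M[X]) (a : A), aeval T r a = r.sum fun n m => ι m * a * ι (θ ^ n) := by
    intro r a
    rw [aeval_eq_sum_range, Polynomial.sum_over_range _ (by simp), LinearMap.sum_apply]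
    refine Finset.sum_congr rfl fun n _ => ?_
    rw [LinearMap.smul_apply, hTpow, hsmul, mul_assoc]
  have hp : aeval T p = 0 := by
    ext a
    have h1 : ∀ r : F[X], aeval T (r.map (algebraMap F M)) a = a * ι (aeval θ r) := fun r => by
      induction r using Polynomial.induction_on' with
      | add r s hr hs =>
        rw [Polynomial.map_add, map_add, LinearMap.add_apply, hr, hs, map_add, map_add, mul_add]
      | monomial n c =>
        rw [Polynomial.map_monomial, aeval_monomial, aeval_monomial, Module.End.mul_apply, hTpow,
          Module.algebraMap_end_apply, hsmul, AlgHom.commutes, map_mul, AlgHom.commutes,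
          ← mul_assoc, ← mul_assoc, Algebra.commutes]
    rw [h1, minpoly.aeval, map_zero, mul_zero, LinearMap.zero_apply]
  have hroot : p.IsRoot (σ θ) := by
    rw [IsRoot.def, eval_map_algebraMap, aeval_algHom_apply, minpoly.aeval, map_zero]
  obtain ⟨r, hr⟩ := dvd_iff_isRoot.2 hroot
  have hpm : p.Monic := (minpoly.monic hint).map _
  have hr0 : r ≠ 0 := by rintro rfl; exact hpm.ne_zero (by rw [hr, mul_zero])
  have hdeg : r.natDegree < (minpoly F θ).natDegree := by
    have h1 : p.natDegree = r.natDegree + 1 := by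
      rw [hr, natDegree_mul (X_sub_C_ne_zero _) hr0, natDegree_X_sub_C, add_comm]
    have h2 : p.natDegree = (minpoly F θ).natDegree := (minpoly.monic hint).natDegree_map _
    omega
  -- `r(T)` is `a ↦ ∑ r_n a θ ^ n` with `deg r < deg θ`; the powers of `θ` involved are independent
  -- over `F`, so its vanishing would force `r = 0`.
  have hne : aeval T r ≠ 0 := by
    intro h0
    have hlin : LinearIndependent F fun i : Fin (minpoly F θ).natDegree => ι (θ ^ (i : ℕ)) :=
      (linearIndependent_pow θ).map' ι.toLinearMap
        (LinearMap.ker_eq_bot.2 ι.toRingHom.injective)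
    have h1 := eq_zero_of_sum_mul_mul_eq_zero hlin
      (a := fun i : Fin (minpoly F θ).natDegree => ι (r.coeff i)) fun a => by
        have := haeval r a
        rw [h0, LinearMap.zero_apply, Polynomial.sum_over_range' _ (by simp) _ hdeg,
          Finset.sum_range] at this
        exact this.symm
    have h2 : ι r.leadingCoeff = 0 := congrFun h1 ⟨r.natDegree, hdeg⟩
    exact hr0 (leadingCoeff_eq_zero.1 (ι.toRingHom.injective (h2.trans (map_zero ι).symm)))
  obtain ⟨a, ha⟩ : ∃ a, aeval T r a ≠ 0 := by
    by_contra! h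
    exact hne (LinearMap.ext h)
  refine ⟨aeval T r a, ha, ?_⟩
  have hθu : aeval T r a * ι θ = ι (σ θ) * aeval T r a := by
    have h1 : aeval T ((X - C (σ θ)) * r) a = 0 := by rw [← hr, hp, LinearMap.zero_apply]
    rw [map_mul, map_sub, aeval_X, aeval_C, Module.End.mul_apply, LinearMap.sub_apply,
      Module.algebraMap_end_apply, sub_eq_zero] at h1
    exact h1
  -- The relation passes from `θ` to all of `M`, since `θ` generates `M` over `F` as an algebra.
  generalize aeval T r a = u at hθu
  intro m
  have hm : m ∈ Algebra.adjoin F {θ} := by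
    rw [← IntermediateField.adjoin_simple_toSubalgebra_of_isAlgebraic hint.isAlgebraic, hθ]; trivial
  induction hm using Algebra.adjoin_induction with
  | mem x hx => rw [Set.mem_singleton_iff.1 hx, hθu]
  | algebraMap c => rw [AlgHom.commutes, AlgEquiv.commutes, AlgHom.commutes, Algebra.commutes]
  | add x y _ _ hx hy => rw [map_add, map_add, map_add, mul_add, add_mul, hx, hy]
  | mul x y _ _ hx hy =>
    rw [map_mul, map_mul, map_mul, ← mul_assoc, hx, mul_assoc, hy, mul_assoc]

/-- The linear combinations of a family indexed by automorphisms of `M`. -/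
noncomputable def crossedSum (ι : M →ₐ[F] A) (u : (M ≃ₐ[F] M) → A) :
    ((M ≃ₐ[F] M) → M) →ₗ[F] A where
  toFun v := ∑ σ, ι (v σ) * u σ
  map_add' x y := by simp [add_mul, Finset.sum_add_distrib]
  map_smul' r x := by simp [Finset.smul_sum]

theorem crossedSum_apply (ι : M →ₐ[F] A) (u : (M ≃ₐ[F] M) → A) (v : (M ≃ₐ[F] M) → M) :
    crossedSum ι u v = ∑ σ, ι (v σ) * u σ := rfl

open Classical in
theorem crossedSum_single (ι : M →ₐ[F] A) (u : (M ≃ₐ[F] M) → A) (σ : M ≃ₐ[F] M) (m : M) :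
    crossedSum ι u (Pi.single σ m) = ι m * u σ := by
  rw [crossedSum_apply, Finset.sum_eq_single σ]
  · simp
  · intro k _ hk; simp [Pi.single_eq_of_ne hk]
  · simp

/-- A family of units of `A` inducing the automorphisms of `M`, which is a basis of `A` over `M`. -/
structure IsCrossedBasis (ι : M →ₐ[F] A) (u : (M ≃ₐ[F] M) → Aˣ) : Prop where
  semilinear : ∀ σ m, u σ * ι m = ι (σ m) * u σ
  bijective : Function.Bijective (crossedSum ι fun σ => (u σ : A))

theorem crossedSum_left (ι : M →ₐ[F] A) (u : (M ≃ₐ[F] M) → A) (v : (M ≃ₐ[F] M) → M) (m : M) :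
    crossedSum ι u (fun σ => m * v σ) = ι m * crossedSum ι u v := by
  simp [crossedSum_apply, Finset.mul_sum, mul_assoc]

theorem crossedSum_right {ι : M →ₐ[F] A} {u : (M ≃ₐ[F] M) → A}
    (hu : ∀ σ m, u σ * ι m = ι (σ m) * u σ) (v : (M ≃ₐ[F] M) → M) (m : M) :
    crossedSum ι u (fun σ => v σ * σ m) = crossedSum ι u v * ι m := by
  simp only [crossedSum_apply, Finset.sum_mul, mul_assoc, map_mul, hu]

open Classical in
-- A normalized relation can involve only one automorphism: a nonzero coordinate at `ρ` forces `ρ =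
-- σ` because `M` is commutative. It then reads `u σ = 0`.
theorem crossedSum_injective {ι : M →ₐ[F] A} {u : (M ≃ₐ[F] M) → A}
    (hu : ∀ σ m, u σ * ι m = ι (σ m) * u σ) (hu0 : ∀ σ, u σ ≠ 0) :
    Function.Injective (crossedSum ι u) := by
  rw [injective_iff_map_eq_zero]
  intro v hv
  by_contra h0
  obtain ⟨w, hw, σ, h1, h⟩ := exists_normalized_mem_of_twisted_bimodule
    (fun σ : M ≃ₐ[F] M => σ.toRingEquiv) (LinearMap.ker (crossedSum ι u)).toAddSubgroup
    (fun v hv s => by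
      simp only [Submodule.mem_toAddSubgroup, LinearMap.mem_ker] at hv ⊢
      rw [crossedSum_left, hv, mul_zero])
    (fun v hv s => by
      simp only [Submodule.mem_toAddSubgroup, LinearMap.mem_ker] at hv ⊢
      exact (crossedSum_right hu v s).trans (by rw [hv, zero_mul])) (v := v) hv h0
  have hwσ : w = Pi.single σ 1 := by
    funext ρ
    by_cases hρ : ρ = σ
    · subst hρ; rw [h1, Pi.single_eq_same]
    · rw [Pi.single_eq_of_ne hρ]
      by_contra hne
      refine hρ (AlgEquiv.ext fun x => ?_)
      have := h ρ (σ x)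
      rw [mul_comm, mul_right_inj' hne] at this
      exact (congrArg ρ (σ.symm_apply_apply x)).symm.trans this.symm
  rw [Submodule.mem_toAddSubgroup, LinearMap.mem_ker, hwσ, crossedSum_single, map_one,
    one_mul] at hw
  exact hu0 σ hw

/-- The coordinates of an element which is semilinear for an automorphism `ρ` on the elements of a
set vanish at the automorphisms which differ from `ρ` on this set. -/
theorem coord_eq_zero_of_semilinear {ι : M →ₐ[F] A} {u : (M ≃ₐ[F] M) → A}
    (hu : ∀ σ m, u σ * ι m = ι (σ m) * u σ) (hinj : Function.Injective (crossedSum ι u))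
    {v : (M ≃ₐ[F] M) → M} {m m' : M} (h : crossedSum ι u v * ι m = ι m' * crossedSum ι u v)
    {σ : M ≃ₐ[F] M} (hσ : σ m ≠ m') : v σ = 0 := by
  rw [← crossedSum_right hu, ← crossedSum_left] at h
  have := congrFun (hinj h) σ
  rw [mul_comm] at this
  by_contra h0
  exact hσ (mul_right_cancel₀ h0 this)

theorem bijective_crossedSum [IsGalois F M] [FiniteDimensional F A]
    (hA : Module.finrank F A = Module.finrank F M ^ 2) {ι : M →ₐ[F] A} {u : (M ≃ₐ[F] M) → A}
    (hu : ∀ σ m, u σ * ι m = ι (σ m) * u σ) (hu0 : ∀ σ, u σ ≠ 0) :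
    Function.Bijective (crossedSum ι u) := by
  have hinj := crossedSum_injective hu hu0
  refine ⟨hinj, (LinearMap.injective_iff_surjective_of_finrank_eq_finrank ?_).1 hinj⟩
  rw [Module.finrank_pi_fintype, hA, Finset.sum_const, smul_eq_mul, Finset.card_univ,
    ← Nat.card_eq_fintype_card, IsGalois.card_aut_eq_finrank, sq]

open Classical in
/-- Nonzero elements of a central simple algebra which induce the automorphisms of a Galois
maximal subfield are units. -/
theorem isUnit_of_semilinear [FiniteDimensional F A] [IsSimpleRing A] {ι : M →ₐ[F] A}
    {u : (M ≃ₐ[F] M) → A} (hu : ∀ σ m, u σ * ι m = ι (σ m) * u σ)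
    (hbij : Function.Bijective (crossedSum ι u)) {a : A} (ha0 : a ≠ 0) {ρ : M ≃ₐ[F] M}
    (ha : ∀ m, a * ι m = ι (ρ m) * a) : IsUnit a := by
  -- The elements semilinear for `σ` are exactly the component `M u σ` of `A`.
  have hhom : ∀ (σ : M ≃ₐ[F] M) (x : A), (∀ m, x * ι m = ι (σ m) * x) →
      ∃ m, x = ι m * u σ := by
    intro σ x hx
    obtain ⟨v, rfl⟩ := hbij.2 x
    refine ⟨v σ, ?_⟩
    rw [← crossedSum_single]
    congr 1
    funext τ
    by_cases hτ : τ = σ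
    · subst hτ; rw [Pi.single_eq_same]
    · rw [Pi.single_eq_of_ne hτ]
      obtain ⟨m, hm⟩ : ∃ m, τ m ≠ σ m := by
        by_contra! h
        exact hτ (AlgEquiv.ext h)
      exact coord_eq_zero_of_semilinear hu hbij.1 (hx m) hm
  obtain ⟨m₁, hm₁⟩ := hhom 1 1 (fun m => by simp)
  have hm₁0 : m₁ ≠ 0 := by rintro rfl; simp at hm₁
  have hu1 : u 1 = ι m₁⁻¹ := by
    calc u 1 = ι m₁⁻¹ * (ι m₁ * u 1) := by
          rw [← mul_assoc, ← map_mul, inv_mul_cancel₀ hm₁0, map_one, one_mul]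
      _ = _ := by rw [← hm₁, mul_one]
  let e := LinearEquiv.ofBijective (crossedSum ι u) hbij
  have hprod : ∀ α β, ∀ m, u α * a * u β * ι m = ι ((α * ρ * β) m) * (u α * a * u β) := by
    intro α β m
    rw [mul_assoc, hu, ← mul_assoc, mul_assoc (u α), ha, ← mul_assoc, hu]
    simp only [mul_assoc, AlgEquiv.mul_apply]
  -- `u α * a * u β` lies in the component of `α * ρ * β`. If all those in the component of `1`
  -- vanished, the whole ideal generated by `a` would have no component there, but by simplicity it
  -- contains `1`.
  obtain ⟨α, β, hone, hne⟩ : ∃ α β, α * ρ * β = 1 ∧ u α * a * u β ≠ 0 := by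
    by_contra! hzero
    have key : ∀ x y, e.symm (x * a * y) 1 = 0 := by
      intro x y
      obtain ⟨v, rfl⟩ := hbij.2 x
      obtain ⟨w, rfl⟩ := hbij.2 y
      rw [crossedSum_apply, crossedSum_apply]
      simp only [Finset.sum_mul, Finset.mul_sum, map_sum, Finset.sum_apply]
      refine Finset.sum_eq_zero fun β _ => Finset.sum_eq_zero fun α _ => ?_
      have h1 : ι (v α) * u α * a * (ι (w β) * u β) =
          ι (v α * α (ρ (w β))) * (u α * a * u β) := by
        rw [← mul_assoc, mul_assoc _ a, ha, ← mul_assoc, mul_assoc _ (u α), hu]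
        simp only [map_mul, mul_assoc]
      rw [h1]
      by_cases hc : α * ρ * β = 1
      · rw [hzero α β hc, mul_zero, map_zero, Pi.zero_apply]
      · obtain ⟨m, hm⟩ := hhom _ _ (hprod α β)
        rw [hm, ← mul_assoc, ← map_mul, ← crossedSum_single]
        have : e.symm (crossedSum ι u (Pi.single (α * ρ * β) (v α * α (ρ (w β)) * m))) =
            Pi.single (α * ρ * β) (v α * α (ρ (w β)) * m) := e.symm_apply_apply _
        rw [this, Pi.single_eq_of_ne (Ne.symm hc)]
    have hP : ∀ x y, e.symm (x * 1 * y) 1 = 0 := by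
      refine IsSimpleRing.one_of_ideal (fun z => ∀ x y, e.symm (x * z * y) 1 = 0) ?_ ?_ ?_ ?_ key ha0
      · intro x y; simp
      · intro z z' hz hz' x y
        rw [mul_add, add_mul, map_add, Pi.add_apply, hz, hz', add_zero]
      · intro s z hz x y
        rw [← mul_assoc, hz]
      · intro s z hz x y
        rw [← mul_assoc, mul_assoc, hz]
    have := hP 1 1
    have h2 : e.symm (crossedSum ι u (Pi.single 1 m₁)) = Pi.single 1 m₁ := e.symm_apply_apply _
    rw [mul_one, mul_one, hm₁, ← crossedSum_single, h2, Pi.single_eq_same] at this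
    exact hm₁0 this
  obtain ⟨m, hm⟩ := hhom 1 _ (fun m => by rw [hprod, hone])
  have hunit : IsUnit (u α * a * u β) := by
    rw [hm, hu1, ← map_mul]
    refine (IsUnit.mk0 _ (mul_ne_zero ?_ (inv_ne_zero hm₁0))).map ι
    rintro rfl
    exact hne (by rw [hm, map_zero, zero_mul])
  -- A factor of a unit is a unit here, one-sided inverses being two-sided in an Artinian ring.
  have : IsArtinianRing A := isArtinian_of_tower F inferInstance
  exact isUnit_of_mul_isUnit_right (isUnit_of_mul_isUnit_left hunit)

theorem exists_isCrossedBasis [IsGalois F M] (hA : IsCSAOfDegree F A (Module.finrank F M))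
    (ι : M →ₐ[F] A) : ∃ u : (M ≃ₐ[F] M) → Aˣ, IsCrossedBasis ι u := by
  have := hA.finite
  have := hA.central
  have := hA.simple
  choose u hu0 hu using exists_ne_zero_semilinear (F := F) (M := M) ι
  have hbij := bijective_crossedSum hA.finrank_eq hu hu0
  choose w hw using fun σ => isUnit_of_semilinear hu hbij (hu0 σ) (hu σ)
  obtain rfl : u = fun σ => (w σ : A) := funext fun σ => (hw σ).symm
  exact ⟨w, hu, hbij⟩

end CrossedProducts

/-! ### Centralizers of the fixed fields -/

section CrossedSubalgebras

variable {F : Type u} {M : Type v} {A : Type w} [Field F] [Field M] [Algebra F M]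
  [Ring A] [Algebra F A]

open IntermediateField

theorem inv_semilinear {ι : M →ₐ[F] A} {w : Aˣ} {σ : M ≃ₐ[F] M}
    (hw : ∀ m, w * ι m = ι (σ m) * w) (m : M) :
    (w⁻¹ : Aˣ) * ι m = ι (σ.symm m) * (w⁻¹ : Aˣ) := by
  rw [Units.inv_mul_eq_iff_eq_mul, ← mul_assoc, hw, σ.apply_symm_apply, mul_assoc, Units.mul_inv,
    mul_one]

theorem pow_semilinear {ι : M →ₐ[F] A} {w : A} {σ : M ≃ₐ[F] M}
    (hw : ∀ m, w * ι m = ι (σ m) * w) (n : ℕ) (m : M) : w ^ n * ι m = ι ((σ ^ n) m) * w ^ n := by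
  induction n with
  | zero => simp
  | succ n ih =>
    rw [pow_succ', mul_assoc, ih, ← mul_assoc, hw, pow_succ', AlgEquiv.mul_apply, mul_assoc]

/-- The centralizer in `A` of the fixed field of a group of automorphisms of `M`. -/
def crossedSubalgebra (ι : M →ₐ[F] A) (H : Subgroup (M ≃ₐ[F] M)) : Subalgebra F A :=
  Subalgebra.centralizer F (ι '' (fixedField H : Set M))

theorem mem_crossedSubalgebra_iff {ι : M →ₐ[F] A} {H : Subgroup (M ≃ₐ[F] M)} {x : A} :
    x ∈ crossedSubalgebra ι H ↔ ∀ z ∈ fixedField H, ι z * x = x * ι z := by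
  rw [crossedSubalgebra, Subalgebra.mem_centralizer_iff]
  exact Set.forall_mem_image

theorem range_le_crossedSubalgebra (ι : M →ₐ[F] A) (H : Subgroup (M ≃ₐ[F] M)) :
    ι.range ≤ crossedSubalgebra ι H := by
  rintro _ ⟨m, rfl⟩
  rw [mem_crossedSubalgebra_iff]
  intro z _
  change ι z * ι m = ι m * ι z
  rw [← map_mul, mul_comm, map_mul]

theorem crossedSubalgebra_mono (ι : M →ₐ[F] A) {H H' : Subgroup (M ≃ₐ[F] M)} (h : H ≤ H') :
    crossedSubalgebra ι H ≤ crossedSubalgebra ι H' := fun x hx => by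
  rw [mem_crossedSubalgebra_iff] at hx ⊢
  exact fun z hz => hx z (fixedField_le h hz)

theorem conj_mem_crossedSubalgebra {ι : M →ₐ[F] A} {H : Subgroup (M ≃ₐ[F] M)} {w : Aˣ}
    {σ : M ≃ₐ[F] M} (hw : ∀ m, w * ι m = ι (σ m) * w)
    (hσ : ∀ z ∈ fixedField H, σ.symm z ∈ fixedField H) {x : A} (hx : x ∈ crossedSubalgebra ι H) :
    (w * x * (w⁻¹ : Aˣ) : A) ∈ crossedSubalgebra ι H := by
  rw [mem_crossedSubalgebra_iff] at hx ⊢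
  intro z hz
  have h1 : ι z * w = w * ι (σ.symm z) := by rw [hw, σ.apply_symm_apply]
  have h2 : (w⁻¹ : Aˣ) * ι z = ι (σ.symm z) * (w⁻¹ : Aˣ) := by
    rw [Units.inv_mul_eq_iff_eq_mul, ← mul_assoc, ← h1, mul_assoc, Units.mul_inv, mul_one]
  rw [← mul_assoc, ← mul_assoc, h1, mul_assoc _ (ι _) x, hx _ (hσ z hz), mul_assoc _ _ (ι z), h2]
  simp only [mul_assoc]

theorem mem_crossedSubalgebra_of_semilinear {ι : M →ₐ[F] A} {H : Subgroup (M ≃ₐ[F] M)} {w : A}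
    {σ : M ≃ₐ[F] M} (hw : ∀ m, w * ι m = ι (σ m) * w) (hσ : σ ∈ H) :
    w ∈ crossedSubalgebra ι H := by
  rw [mem_crossedSubalgebra_iff]
  intro z hz
  rw [hw, (mem_fixedField_iff _ _).1 hz σ hσ]

variable [FiniteDimensional F M]

theorem mem_of_forall_fixedField {H : Subgroup (M ≃ₐ[F] M)} {σ : M ≃ₐ[F] M}
    (h : ∀ z ∈ fixedField H, σ z = z) : σ ∈ H := by
  rw [← fixingSubgroup_fixedField H, IntermediateField.mem_fixingSubgroup_iff]
  exact h

theorem crossedSubalgebra_top_eq_top (ι : M →ₐ[F] A) [IsGalois F M] : crossedSubalgebra ι ⊤ = ⊤ := by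
  rw [eq_top_iff]
  intro x _
  rw [mem_crossedSubalgebra_iff]
  intro z hz
  rw [IsGalois.fixedField_top, IntermediateField.mem_bot] at hz
  obtain ⟨r, rfl⟩ := hz
  rw [AlgHom.commutes, Algebra.commutes]

namespace IsCrossedBasis

variable {ι : M →ₐ[F] A} {u : (M ≃ₐ[F] M) → Aˣ}

theorem nontrivial (hu : IsCrossedBasis ι u) : Nontrivial A := hu.bijective.1.nontrivial

/-- Commuting with `z` kills the coordinates at all `σ` moving `z`; for `σ ∉ H` the Galois
correspondence provides such a `z` in `Fix(H)`. -/
theorem mem_crossedSubalgebra_iff_coord (hu : IsCrossedBasis ι u) {H : Subgroup (M ≃ₐ[F] M)} {v : (M ≃ₐ[F] M) → M} :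
    crossedSum ι (fun σ => (u σ : A)) v ∈ crossedSubalgebra ι H ↔ ∀ σ, σ ∉ H → v σ = 0 := by
  constructor
  · intro hx σ hσ
    obtain ⟨z, hz, hne⟩ : ∃ z ∈ fixedField H, σ z ≠ z := by
      by_contra! h
      exact hσ (mem_of_forall_fixedField h)
    exact coord_eq_zero_of_semilinear hu.semilinear hu.bijective.1
      (mem_crossedSubalgebra_iff.1 hx z hz).symm hne
  · intro hv
    rw [crossedSum_apply]
    refine Subalgebra.sum_mem _ fun σ _ => ?_
    by_cases hσ : σ ∈ H
    · exact Subalgebra.mul_mem _ (range_le_crossedSubalgebra ι H ⟨_, rfl⟩)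
        (mem_crossedSubalgebra_of_semilinear (hu.semilinear σ) hσ)
    · rw [hv σ hσ, map_zero, zero_mul]
      exact Subalgebra.zero_mem _

open Classical in
-- Only the coordinate at `1` survives. As `u 1` is not normalized to be `1`, it is placed in `M` by
-- applying this to the element `1`.
theorem mem_range_of_commute (hu : IsCrossedBasis ι u) {x : A} (hx : ∀ m, ι m * x = x * ι m) : x ∈ ι.range := by
  have hcoord : ∀ y : A, (∀ m, ι m * y = y * ι m) → ∃ m, y = ι m * u 1 := by
    intro y hy
    obtain ⟨v, rfl⟩ := hu.bijective.2 y
    have := (hu.mem_crossedSubalgebra_iff_coord (H := ⊥) (v := v)).1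
      (mem_crossedSubalgebra_iff.2 fun z _ => hy z)
    refine ⟨v 1, ?_⟩
    rw [crossedSum_apply, Finset.sum_eq_single 1]
    · intro σ _ hσ
      rw [this σ (by rwa [Subgroup.mem_bot]), map_zero, zero_mul]
    · simp
  obtain ⟨m, rfl⟩ := hcoord x hx
  obtain ⟨m₁, hm₁⟩ := hcoord 1 (by simp)
  have hinv : (u 1 : A) = ι m₁⁻¹ := by
    have := hu.nontrivial
    have hm₁0 : m₁ ≠ 0 := by rintro rfl; simp at hm₁
    calc (u 1 : A) = ι m₁⁻¹ * (ι m₁ * u 1) := by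
          rw [← mul_assoc, ← map_mul, inv_mul_cancel₀ hm₁0, map_one, one_mul]
      _ = _ := by rw [← hm₁, mul_one]
  exact ⟨m * m₁⁻¹, by rw [hinv]; exact map_mul ι m m₁⁻¹⟩

theorem crossedSubalgebra_bot (hu : IsCrossedBasis ι u) : crossedSubalgebra ι ⊥ = ι.range := by
  refine le_antisymm (fun x hx => hu.mem_range_of_commute fun m => ?_)
    (range_le_crossedSubalgebra ι ⊥)
  exact mem_crossedSubalgebra_iff.1 hx m (by rw [fixedField_bot]; trivial)

open Classical in
theorem finrank_crossedSubalgebra (hu : IsCrossedBasis ι u) (H : Subgroup (M ≃ₐ[F] M)) :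
    Module.finrank F (crossedSubalgebra ι H) = Nat.card H * Module.finrank F M := by
  let ext0 : (H → M) →ₗ[F] ((M ≃ₐ[F] M) → M) :=
    { toFun := fun v σ => if h : σ ∈ H then v ⟨σ, h⟩ else 0
      map_add' := fun v w => by ext σ; by_cases h : σ ∈ H <;> simp [h]
      map_smul' := fun r v => by ext σ; by_cases h : σ ∈ H <;> simp [h] }
  have hinj : Function.Injective ext0 := fun v w h => by
    funext σ
    have := congrFun h σ
    simpa [ext0] using this
  let f := (crossedSum ι fun σ => (u σ : A)).comp ext0
  have hrange : LinearMap.range f = Subalgebra.toSubmodule (crossedSubalgebra ι H) := by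
    ext x
    constructor
    · rintro ⟨v, rfl⟩
      exact hu.mem_crossedSubalgebra_iff_coord.2 fun σ hσ => dif_neg hσ
    · intro hx
      obtain ⟨v, rfl⟩ := hu.bijective.2 x
      have hv := hu.mem_crossedSubalgebra_iff_coord.1 hx
      refine ⟨fun σ => v σ, ?_⟩
      change crossedSum ι _ _ = _
      congr 1
      funext σ
      by_cases h : σ ∈ H
      · exact dif_pos h
      · exact (dif_neg h).trans (hv σ h).symm
  have h1 : Module.finrank F (LinearMap.range f) = Module.finrank F (H → M) :=
    LinearMap.finrank_range_of_inj (hu.bijective.1.comp hinj)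
  rw [hrange] at h1
  refine h1.trans ?_
  rw [Module.finrank_pi_fintype, Finset.sum_const, smul_eq_mul, Finset.card_univ,
    Nat.card_eq_fintype_card]

/-- A central element commutes with `M`, hence lies in `M`; commuting with `u σ` means being fixed
by `σ`. -/
theorem center_crossedSubalgebra (hu : IsCrossedBasis ι u) (H : Subgroup (M ≃ₐ[F] M)) {x : crossedSubalgebra ι H} :
    x ∈ Subalgebra.center F (crossedSubalgebra ι H) ↔ ∃ z ∈ fixedField H, ι z = x := by
  rw [Subalgebra.mem_center_iff]
  constructor
  · intro hx
    obtain ⟨m, hm⟩ : (x : A) ∈ ι.range := hu.mem_range_of_commute fun m =>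
      congrArg Subtype.val (hx ⟨ι m, range_le_crossedSubalgebra ι H ⟨m, rfl⟩⟩)
    change ι m = x at hm
    refine ⟨m, (mem_fixedField_iff _ _).2 fun σ hσ => ?_, hm⟩
    have h1 : (u σ : A) * x = x * u σ := congrArg Subtype.val
      (hx ⟨u σ, mem_crossedSubalgebra_of_semilinear (hu.semilinear σ) hσ⟩)
    rw [← hm, hu.semilinear] at h1
    have := hu.nontrivial
    exact ι.toRingHom.injective ((u σ).isUnit.mul_right_cancel h1)
  · rintro ⟨z, hz, hx⟩ b
    apply Subtype.ext
    change (b : A) * x = x * b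
    rw [← hx, mem_crossedSubalgebra_iff.1 b.2 z hz]

theorem isMaximalSubfield (hu : IsCrossedBasis ι u) (H : Subgroup (M ≃ₐ[F] M)) :
    IsMaximalSubfield ι (crossedSubalgebra ι H) := by
  refine ⟨range_le_crossedSubalgebra ι H, fun L hL _ hle => le_antisymm (fun x hx => ?_) hle⟩
  exact hu.mem_range_of_commute fun m =>
    congrArg Subtype.val (hL.mul_comm ⟨ι m, hle ⟨m, rfl⟩⟩ ⟨x, hx⟩)

/-- The degree is `|H|`: with `Z` the center, `dim_F = |H| [M : F]` and `[M : F] = |H| [Z : F]`, so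
`dim_Z = |H| ^ 2`. -/
theorem isStrictlyMaximalSubfield (hu : IsCrossedBasis ι u) [IsGalois F M] [FiniteDimensional F A]
    (H : Subgroup (M ≃ₐ[F] M)) [IsSimpleRing (crossedSubalgebra ι H)] :
    IsStrictlyMaximalSubfield ι (crossedSubalgebra ι H) := by
  have := hu.nontrivial
  let B := crossedSubalgebra ι H
  let f : fixedField H →ₐ[F] B :=
    (Subalgebra.inclusion (range_le_crossedSubalgebra ι H)).comp
      (ι.rangeRestrict.comp (fixedField H).val)
  have hf : f.range = Subalgebra.center F B := by
    ext x
    rw [hu.center_crossedSubalgebra H]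
    exact ⟨fun ⟨z, hz⟩ => ⟨z, z.2, congrArg Subtype.val hz⟩,
      fun ⟨z, hz, h⟩ => ⟨⟨z, hz⟩, Subtype.ext h⟩⟩
  have hZ : Module.finrank F (Subalgebra.center F B) = Module.finrank F (fixedField H) := by
    rw [← hf]
    exact (AlgEquiv.ofInjective f f.toRingHom.injective).toLinearEquiv.finrank_eq.symm
  have hM : Module.finrank F M = Nat.card H * Module.finrank F (Subalgebra.center F B) := by
    rw [hZ, ← finrank_fixedField_eq_card H, mul_comm, Module.finrank_mul_finrank]
  let : Algebra F (Subring.center B) := ((algebraMap F B).codRestrict (Subring.center B)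
    fun r => Subring.mem_center_iff.2 fun b => (Algebra.commutes r b).symm).toAlgebra
  have : IsScalarTower F (Subring.center B) B := IsScalarTower.of_algebraMap_eq fun _ => rfl
  let eZ : Subalgebra.center F B ≃ₗ[F] Subring.center B :=
    { toFun := fun x => ⟨x, Subring.mem_center_iff.2 (Subalgebra.mem_center_iff.1 x.2)⟩
      invFun := fun x => ⟨x, Subalgebra.mem_center_iff.2 (Subring.mem_center_iff.1 x.2)⟩
      map_add' := fun _ _ => rfl
      map_smul' := fun r x => Subtype.ext (Algebra.smul_def r (x : B))
      left_inv := fun _ => rfl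
      right_inv := fun _ => rfl }
  have : Module.Free (Subring.center B) B := by
    let := (IsSimpleRing.isField_center B).toField
    exact Module.Free.of_divisionRing _ _
  refine ⟨range_le_crossedSubalgebra ι H, ?_, Nat.card H, ⟨?_, ?_, inferInstance, ?_⟩, hM⟩
  · rintro _ ⟨x, hx, rfl⟩
    obtain ⟨z, _, hz⟩ := (hu.center_crossedSubalgebra H).1 hx
    exact ⟨z, hz⟩
  · exact Module.Finite.right F (Subring.center B) B
  · exact ⟨fun x hx => ⟨⟨x, Subring.mem_center_iff.2 (Subalgebra.mem_center_iff.1 hx)⟩, rfl⟩⟩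
  · have h1 := Module.finrank_mul_finrank F (Subring.center B) B
    rw [← eZ.finrank_eq, hu.finrank_crossedSubalgebra, hM, mul_comm, ← mul_assoc, ← sq] at h1
    exact Nat.eq_of_mul_eq_mul_right Module.finrank_pos h1

end IsCrossedBasis

end CrossedSubalgebras

/-! ### One step of prime index -/

section CyclicSteps

variable {F : Type u} {M : Type v} {A : Type w} [Field F] [Field M] [Algebra F M]
  [Ring A] [Algebra F A]

open IntermediateField

/-- The automorphism of a subalgebra induced by conjugation with a unit which normalizes it. -/
def conjAlgEquiv (B : Subalgebra F A) (w : Aˣ) (h : ∀ x ∈ B, (w * x * (w⁻¹ : Aˣ) : A) ∈ B)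
    (h' : ∀ x ∈ B, ((w⁻¹ : Aˣ) * x * w : A) ∈ B) : B ≃ₐ[F] B where
  toFun x := ⟨w * x * (w⁻¹ : Aˣ), h x x.2⟩
  invFun x := ⟨(w⁻¹ : Aˣ) * x * w, h' x x.2⟩
  left_inv x := Subtype.ext (by simp [mul_assoc])
  right_inv x := Subtype.ext (by simp [mul_assoc])
  map_mul' x y := Subtype.ext (by simp [mul_assoc])
  map_add' x y := Subtype.ext (by simp [mul_add, add_mul])
  commutes' r := Subtype.ext (by
    change (w * algebraMap F A r * (w⁻¹ : Aˣ) : A) = algebraMap F A r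
    rw [← Algebra.commutes, mul_assoc, Units.mul_inv, mul_one])

theorem conjAlgEquiv_mul (B : Subalgebra F A) (w : Aˣ) (h h') (x : B) :
    (w : A) * x = (conjAlgEquiv B w h h' x : A) * w := by
  change (w : A) * x = w * x * (w⁻¹ : Aˣ) * w
  rw [mul_assoc, Units.inv_mul, mul_one]

/-- Otherwise Bézout would express `g` through `g ^ q` and `g ^ n`, both in `H`. -/
theorem dvd_of_pow_mem {G : Type*} [Group G] {H : Subgroup G} {g : G} {q n : ℕ} (hq : q.Prime)
    (hgq : g ^ q ∈ H) (hg : g ∉ H) (hn : g ^ n ∈ H) : q ∣ n := by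
  by_contra h
  have hcop : Nat.gcd q n = 1 := (Nat.Prime.coprime_iff_not_dvd hq).2 h
  refine hg ?_
  have h1 := Nat.gcd_eq_gcd_ab q n
  rw [hcop, Nat.cast_one] at h1
  rw [← zpow_one g, h1, zpow_add, zpow_mul, zpow_mul, zpow_natCast, zpow_natCast]
  exact H.mul_mem (H.zpow_mem hgq _) (H.zpow_mem hn _)

/-- The condition on the consecutive members of a generalised cyclic chain. -/
def IsGeneralisedCyclicStep (ι : M →ₐ[F] A) (B B' : Subalgebra F A) : Prop :=
  ∃ (q : ℕ) (τ : B ≃ₐ[F] B) (c : B) (φ : B' →ₗ[F] SkewPolynomial B),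
    IsCyclicStep ι B B' q τ c φ ∧
      IsLeast {n : ℕ | 0 < n ∧ ∀ z ∈ Subalgebra.center F B, (τ ^ n) z = z} q ∧
      IsRightInvariant τ (twistedBinomial τ q c) ∧
      ∀ (x : B) (y : B'), (x : A) = y → φ y = SkewPolynomial.C x

variable [FiniteDimensional F M] {ι : M →ₐ[F] A} {u : (M ≃ₐ[F] M) → Aˣ}

/-- The step is realised inside `A` by `t = u σ`: `τ` is conjugation by `t`, and `c = t ^ q` lies in
the smaller centralizer because `σ ^ q ∈ H`. -/
theorem IsCrossedBasis.isGeneralisedCyclicStep [FiniteDimensional F A] (hu : IsCrossedBasis ι u)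
    {H H' : Subgroup (M ≃ₐ[F] M)} (hle : H ≤ H') {σ : M ≃ₐ[F] M} (hσ' : σ ∈ H') (hσ : σ ∉ H)
    (hnorm : ∀ ρ ∈ H, σ * ρ * σ⁻¹ ∈ H) (hnorm' : ∀ ρ ∈ H, σ⁻¹ * ρ * σ ∈ H) {q : ℕ}
    (hq : q.Prime) (hσq : σ ^ q ∈ H) (hcard : Nat.card H' = q * Nat.card H)
    [IsSimpleRing (crossedSubalgebra ι H)] :
    IsSimpleRing (crossedSubalgebra ι H') ∧
      IsGeneralisedCyclicStep ι (crossedSubalgebra ι H) (crossedSubalgebra ι H') := by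
  have := hu.nontrivial
  let B := crossedSubalgebra ι H
  let B' := crossedSubalgebra ι H'
  have hBB' : B ≤ B' := crossedSubalgebra_mono ι hle
  let w := u σ
  have hw : ∀ m, w * ι m = ι (σ m) * w := hu.semilinear σ
  have hfix : ∀ z ∈ fixedField H, σ z ∈ fixedField H := fun z hz => by
    rw [mem_fixedField_iff] at hz ⊢
    intro ρ hρ
    have := hz _ (hnorm' ρ hρ)
    rw [AlgEquiv.mul_apply, AlgEquiv.mul_apply] at this
    exact (σ.apply_symm_apply _).symm.trans (congrArg σ this)
  have hfix' : ∀ z ∈ fixedField H, σ.symm z ∈ fixedField H := fun z hz => by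
    rw [mem_fixedField_iff] at hz ⊢
    intro ρ hρ
    have := hz _ (hnorm ρ hρ)
    rw [AlgEquiv.mul_apply, AlgEquiv.mul_apply] at this
    exact (σ.symm_apply_apply _).symm.trans (congrArg σ.symm this)
  have hconj : ∀ x ∈ B, (w * x * (w⁻¹ : Aˣ) : A) ∈ B := fun x hx =>
    conj_mem_crossedSubalgebra hw hfix' hx
  have hconj' : ∀ x ∈ B, ((w⁻¹ : Aˣ) * x * w : A) ∈ B := fun x hx => by
    have := conj_mem_crossedSubalgebra (w := w⁻¹) (σ := σ.symm) (inv_semilinear hw) hfix hx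
    rwa [inv_inv] at this
  let τ : B ≃ₐ[F] B := conjAlgEquiv B w hconj hconj'
  have hτ : ∀ x : B, (w : A) * x = τ x * w := conjAlgEquiv_mul B w hconj hconj'
  have hτn : ∀ (n : ℕ) (x : B), (w : A) ^ n * x = ((τ ^ n) x : B) * (w : A) ^ n :=
    pow_mul_of_twisted (j := B.val) hτ
  have hwB : (w : A) ^ q ∈ B := mem_crossedSubalgebra_of_semilinear (pow_semilinear hw q) hσq
  have hwB_inv : (((w ^ q)⁻¹ : Aˣ) : A) ∈ B :=
    mem_crossedSubalgebra_of_semilinear (σ := (σ ^ q).symm)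
      (inv_semilinear (w := w ^ q) (by simpa using pow_semilinear hw q)) (H.inv_mem hσq)
  let c : Bˣ :=
    { val := ⟨(w : A) ^ q, hwB⟩
      inv := ⟨_, hwB_inv⟩
      val_inv := Subtype.ext (by
        change (w : A) ^ q * ((w ^ q)⁻¹ : Aˣ) = 1
        rw [← Units.val_pow_eq_pow_val, Units.mul_inv])
      inv_val := Subtype.ext (by
        change (((w ^ q)⁻¹ : Aˣ) : A) * (w : A) ^ q = 1
        rw [← Units.val_pow_eq_pow_val, Units.inv_mul]) }
  have hc : ((c : B) : A) = (w : A) ^ q := rfl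
  have hcτ : ∀ s : B, (c : B) * s = (τ ^ q) s * c := fun s => Subtype.ext (hτn q s)
  have hτc : τ c = c := by
    apply Subtype.ext
    apply w.isUnit.mul_right_cancel
    rw [← hτ, hc, ← pow_succ, ← pow_succ']
  have hτz : ∀ (n : ℕ) (z : B) (m : M), ι m = z → (((τ ^ n) z : B) : A) = ι ((σ ^ n) m) := by
    intro n z m hz
    apply (w.isUnit.pow n).mul_right_cancel
    rw [← hτn, ← hz, pow_semilinear hw]
  -- On the center, a copy of `Fix(H)`, `τ` acts as `σ`. Inner automorphisms are trivial there, so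
  -- this bounds both the inner order and the order on the center from below by `q`.
  have hpow : ∀ n : ℕ, (∀ z ∈ Subalgebra.center F B, (τ ^ n) z = z) → σ ^ n ∈ H := by
    intro n hn
    refine mem_of_forall_fixedField fun z hz => ?_
    let z' : B := ⟨ι z, range_le_crossedSubalgebra ι H ⟨z, rfl⟩⟩
    have h1 := hn z' ((hu.center_crossedSubalgebra H).2 ⟨z, hz, rfl⟩)
    have h2 := hτz n z' z rfl
    rw [h1] at h2
    exact ι.toRingHom.injective h2.symm
  have hdvd : ∀ n : ℕ, 0 < n → (∀ z ∈ Subalgebra.center F B, (τ ^ n) z = z) → q ≤ n :=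
    fun n hn h => Nat.le_of_dvd hn (dvd_of_pow_mem hq hσq hσ (hpow n h))
  have hinner : HasInnerOrder τ q := by
    refine ⟨⟨hq.pos, c, fun x => ?_⟩, ?_⟩
    · rw [hcτ, mul_assoc, Units.mul_inv, mul_one]
    · rintro n ⟨hn, v, hv⟩
      refine hdvd n hn fun z hz => ?_
      rw [hv, Subalgebra.mem_center_iff.1 hz, mul_assoc, Units.mul_inv, mul_one]
  have hleast : IsLeast {n : ℕ | 0 < n ∧ ∀ z ∈ Subalgebra.center F B, (τ ^ n) z = z} q := by
    refine ⟨⟨hq.pos, fun z hz => ?_⟩, fun n hn => hdvd n hn.1 hn.2⟩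
    apply c.isUnit.mul_right_cancel
    rw [← hcτ, Subalgebra.mem_center_iff.1 hz]
  have hwB' : (w : A) ∈ B' := mem_crossedSubalgebra_of_semilinear hw hσ'
  have hwB'_inv : ((w⁻¹ : Aˣ) : A) ∈ B' :=
    mem_crossedSubalgebra_of_semilinear (inv_semilinear hw) (H'.inv_mem hσ')
  let t : B' := ⟨w, hwB'⟩
  have ht : IsUnit t := ⟨⟨t, ⟨_, hwB'_inv⟩, Subtype.ext w.mul_inv, Subtype.ext w.inv_mul⟩, rfl⟩
  let j : B →ₐ[F] B' := Subalgebra.inclusion hBB'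
  have hcomm : ∀ s, t * j s = j (τ s) * t := fun s => Subtype.ext (hτ s)
  -- Independence of the powers of `t` comes from the inner order, generation from a count of
  -- dimensions over `F`.
  have hext : IsTwistedExtension j τ q t := by
    have hinj : Function.Injective (twistedEval j q t) := hinner.twistedEval_injective hcomm ht
    refine ⟨hcomm, ht, hinj,
      (LinearMap.injective_iff_surjective_of_finrank_eq_finrank ?_).1 hinj⟩
    rw [Module.finrank_pi_fintype, Finset.sum_const, smul_eq_mul, Finset.card_univ,
      Fintype.card_fin, hu.finrank_crossedSubalgebra, hu.finrank_crossedSubalgebra, hcard,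
      mul_assoc]
  have htq : t ^ q = j c := Subtype.ext rfl
  obtain ⟨φ, hφ, hφj⟩ := hext.exists_isTwistedQuotientIso hq.pos htq
  refine ⟨hext.isSimpleRing hinner, q, τ, c, φ,
    ⟨lt_of_le_of_ne hBB' fun h => ?_, hq, hinner, ⟨σ, fun x m hx => ?_⟩, hτc, c.isUnit, hφ⟩,
    hleast, isRightInvariant_twistedBinomial hτc hcτ, fun x y hxy => ?_⟩
  · have hwmem : (w : A) ∈ B := h.ge hwB'
    refine hσ (mem_of_forall_fixedField fun z hz => ι.toRingHom.injective ?_)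
    apply w.isUnit.mul_right_cancel
    exact (hw z).symm.trans (mem_crossedSubalgebra_iff.1 hwmem z hz).symm
  · simpa using hτz 1 x m hx.symm
  · rw [← hφj]
    exact congrArg φ (Subtype.ext hxy.symm)

end CyclicSteps

/-! ### Solvable groups -/

section Groups

/-- A nontrivial finite solvable group has a normal subgroup of prime index. -/
theorem exists_normal_prime_index (G : Type*) [Group G] [Finite G] [Nontrivial G]
    [Group.IsSolvable G] : ∃ N : Subgroup G, N.Normal ∧ N.index.Prime := by
  -- A maximal subgroup containing the commutator subgroup is normal, with simple abelian quotient,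
  -- hence of prime index.
  obtain ⟨N, hN, hle⟩ := (eq_top_or_exists_le_coatom (commutator G)).resolve_left
    (Group.IsSolvable.commutator_lt_top_of_nontrivial G).ne
  have hnormal : N.Normal := Subgroup.Normal.of_commutator_le G hle
  have hcomm : IsMulCommutative (G ⧸ N) :=
    Subgroup.Normal.quotient_commutative_iff_commutator_le.2 hle
  have : Nontrivial (G ⧸ N) := by
    rw [QuotientGroup.nontrivial_iff]; exact hN.1
  have : IsSimpleGroup (G ⧸ N) := by
    refine ⟨fun K _ => ?_⟩
    have hK : N ≤ K.comap (QuotientGroup.mk' N) := fun x hx => by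
      rw [Subgroup.mem_comap, QuotientGroup.mk'_apply, (QuotientGroup.eq_one_iff x).2 hx]
      exact K.one_mem
    rcases hN.le_iff.1 hK with h | h
    · right
      rw [eq_top_iff]
      intro x _
      obtain ⟨g, rfl⟩ := QuotientGroup.mk'_surjective N x
      have : g ∈ K.comap (QuotientGroup.mk' N) := h ▸ Subgroup.mem_top g
      exact this
    · left
      rw [eq_bot_iff]
      intro x hx
      obtain ⟨g, rfl⟩ := QuotientGroup.mk'_surjective N x
      have : g ∈ N := h ▸ hx
      exact (QuotientGroup.eq_one_iff g).2 this
  let : CommGroup (G ⧸ N) :=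
    { (inferInstance : Group (G ⧸ N)) with mul_comm := hcomm.is_comm.comm }
  exact ⟨N, hnormal, IsSimpleGroup.prime_card⟩

end Groups

/-! ### Assembling the chain -/

section MainTheorem

variable {F : Type u} {M : Type v} {A : Type w} [Field F] [Field M] [Algebra F M]
  [Ring A] [Algebra F A]

open IntermediateField

theorem IsGeneralisedCyclicChain.isCyclicChain {ι : M →ₐ[F] A} {k : ℕ} {B : ℕ → Subalgebra F A}
    (h : IsGeneralisedCyclicChain ι k B) : IsCyclicChain ι k B where
  zero := h.zero
  maximal i hi := (h.maximal i hi).1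
  step i hi := by
    obtain ⟨q, τ, c, φ, hs, -⟩ := h.step i hi
    exact ⟨q, τ, c, φ, hs⟩

variable [FiniteDimensional F M]

/-- Induction on `|H|`, splitting off the top step at a normal subgroup of prime index. Simplicity
is carried along because each step needs it for the smaller algebra. -/
theorem IsCrossedBasis.exists_subgroup_chain [FiniteDimensional F A] {ι : M →ₐ[F] A}
    {u : (M ≃ₐ[F] M) → Aˣ} (hu : IsCrossedBasis ι u) (H : Subgroup (M ≃ₐ[F] M))
    [Group.IsSolvable H] :
    ∃ (k : ℕ) (S : ℕ → Subgroup (M ≃ₐ[F] M)), S 0 = ⊥ ∧ S k = H ∧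
      (∀ i, i ≤ k → IsSimpleRing (crossedSubalgebra ι (S i))) ∧
      ∀ i, i < k → IsGeneralisedCyclicStep ι (crossedSubalgebra ι (S i))
        (crossedSubalgebra ι (S (i + 1))) := by
  obtain ⟨n, hn⟩ : ∃ n, n = Nat.card H := ⟨_, rfl⟩
  induction n using Nat.strong_induction_on generalizing H with
  | _ n ih =>
    rcases eq_or_ne H ⊥ with rfl | hH
    · refine ⟨0, fun _ => ⊥, rfl, rfl, fun _ _ => ?_, fun i hi => absurd hi (Nat.not_lt_zero i)⟩
      have := hu.nontrivial
      rw [hu.crossedSubalgebra_bot]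
      exact isSimpleRing_range ι
    · have : Nontrivial H := (Subgroup.nontrivial_iff_ne_bot H).2 hH
      obtain ⟨N, hN, hq⟩ := exists_normal_prime_index H
      let H₀ := N.map H.subtype
      have hmem : ∀ x : H, (x : M ≃ₐ[F] M) ∈ H₀ ↔ x ∈ N := fun x =>
        Subgroup.mem_map_iff_mem H.subtype_injective
      have hle : H₀ ≤ H := by rintro _ ⟨x, _, rfl⟩; exact x.2
      have hcardN : Nat.card H₀ = Nat.card N := Subgroup.card_map_of_injective H.subtype_injective
      have hcard : Nat.card H = N.index * Nat.card H₀ := by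
        rw [hcardN, mul_comm, N.card_mul_index]
      have hlt : Nat.card H₀ < Nat.card H := by
        rw [hcard]
        exact lt_mul_of_one_lt_left Nat.card_pos hq.one_lt
      have : Group.IsSolvable H₀ :=
        Group.isSolvable_of_isSolvable_injective (f := Subgroup.inclusion hle)
          (Subgroup.inclusion_injective hle)
      obtain ⟨k, S, hS0, hSk, hsimple, hstep⟩ := ih _ (hn ▸ hlt) H₀ rfl
      obtain ⟨σ, hσ⟩ : ∃ σ : H, σ ∉ N := by
        by_contra! h
        exact hq.ne_one (Subgroup.index_eq_one.2 (eq_top_iff.2 fun x _ => h x))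
      have : IsSimpleRing (crossedSubalgebra ι H₀) := hSk ▸ hsimple k le_rfl
      obtain ⟨hs, hst⟩ := hu.isGeneralisedCyclicStep hle σ.2 (fun h => hσ ((hmem σ).1 h))
        (by
          rintro _ ⟨x, hx, rfl⟩
          exact (hmem (σ * x * σ⁻¹)).2 (hN.conj_mem x hx σ))
        (by
          rintro _ ⟨x, hx, rfl⟩
          have := hN.conj_mem x hx σ⁻¹
          rw [inv_inv] at this
          exact (hmem (σ⁻¹ * x * σ)).2 this) hq
        ((hmem (σ ^ N.index)).2 (N.pow_index_mem σ)) hcard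
      obtain ⟨S', hS, hS'⟩ : ∃ S' : ℕ → Subgroup (M ≃ₐ[F] M), (∀ i, i ≤ k → S' i = S i) ∧
          S' (k + 1) = H :=
        ⟨fun i => if i ≤ k then S i else H, fun i hi => if_pos hi, if_neg (by omega)⟩
      refine ⟨k + 1, S', (hS 0 (by omega)).trans hS0, hS', fun i hi => ?_, fun i hi => ?_⟩
      · rcases Nat.le_or_eq_of_le_succ hi with h | rfl
        · rw [hS i h]; exact hsimple i h
        · rw [hS']; exact hs
      · rcases Nat.lt_or_ge i k with h | h
        · rw [hS i h.le, hS (i + 1) h]; exact hstep i h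
        · obtain rfl : i = k := by omega
          rw [hS i le_rfl, hS', hSk]; exact hst

theorem center_top_map_eq {ι : M →ₐ[F] A} [IsGalois F M] [Algebra.IsCentral F A] :
    (Subalgebra.center F (⊤ : Subalgebra F A)).map (⊤ : Subalgebra F A).val =
      (fixedField (⊤ : Subgroup (M ≃ₐ[F] M))).toSubalgebra.map ι := by
  ext x
  rw [IsGalois.fixedField_top, bot_toSubalgebra, Algebra.map_bot,
    ← Algebra.IsCentral.center_eq_bot F A, Subalgebra.mem_center_iff]
  constructor
  · rintro ⟨y, hy, rfl⟩ b
    exact congrArg Subtype.val (Subalgebra.mem_center_iff.1 hy ⟨b, trivial⟩)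
  · intro hx
    exact ⟨⟨x, trivial⟩, Subalgebra.mem_center_iff.2 fun b => Subtype.ext (hx b), rfl⟩

end MainTheorem

theorem mainTheorem10 {F : Type u} {M : Type v} {A : Type w} [Field F] [Field M] [Algebra F M]
    [FiniteDimensional F M] [Nontrivial (M ≃ₐ[F] M)] [Ring A] [Algebra F A]
    (hA : IsCSAOfDegree F A (Module.finrank F M)) (ι : M →ₐ[F] A) :
    ((∃ (k : ℕ) (B : ℕ → Subalgebra F A), IsCyclicChain ι k B ∧
        IsCrossedProductOver ι (IntermediateField.fixedField (⊤ : Subgroup (M ≃ₐ[F] M))) (B k)) →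
      Group.IsSolvable (M ≃ₐ[F] M)) ∧
    (IsGalois F M →
      List.TFAE [
        Group.IsSolvable (M ≃ₐ[F] M),
        ∃ (k : ℕ) (B : ℕ → Subalgebra F A), IsCyclicChain ι k B ∧ B k = ⊤,
        ∃ (k : ℕ) (B : ℕ → Subalgebra F A), IsGeneralisedCyclicChain ι k B ∧ B k = ⊤]) := by
  have := hA.finite
  have := hA.central
  have := hA.simple
  refine ⟨fun ⟨k, B, hB, hc⟩ => hB.isSolvable hc.center_eq, fun _ => ?_⟩
  tfae_have 1 → 3 := by
    intro _
    obtain ⟨u, hu⟩ := exists_isCrossedBasis hA ι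
    obtain ⟨k, S, h0, hk, hsimple, hstep⟩ := hu.exists_subgroup_chain ⊤
    refine ⟨k, fun i => crossedSubalgebra ι (S i), ⟨?_, fun i hi => ?_, hstep⟩, ?_⟩
    · rw [h0, hu.crossedSubalgebra_bot]
    · have := hsimple i hi
      exact ⟨hu.isMaximalSubfield _, hu.isStrictlyMaximalSubfield _⟩
    · exact (congrArg (crossedSubalgebra ι) hk).trans (crossedSubalgebra_top_eq_top ι)
  tfae_have 3 → 2 := fun ⟨k, B, hB, hk⟩ => ⟨k, B, hB.isCyclicChain, hk⟩
  -- For `M/F` Galois, `Fix(G) = F` is the center of `A`, so the solvability argument for chains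
  -- applies with last algebra `A`.
  tfae_have 2 → 1 := by
    rintro ⟨k, B, hB, hk⟩
    refine hB.isSolvable ?_
    rw [hk]
    exact center_top_map_eq
  tfae_finish
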